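/- **Setting.** Let $A$ be a finite-dimensional real alternative algebra (not necessarily associative) with unit $1\ne 0$ and a $^*$-involution $x\mapsto x^c$ (real linear, $(x^c)^c=x$, $(xy)^c=y^cx^c$, $r^c=r$ for $r\in\mathbb R=\mathbb R1$). Put $$\mathbb S_A=\{x: x+x^c=0,\ xx^c=1\},\qquad Q_A=\mathbb R\cup\{x: t=x+x^c\in\mathbb R,\ n=xx^c\in\mathbb R,\ t^2<4n\},$$ assume $\mathbb S_A\neq\emptyset$, and let $\|\cdot\|_A$ be a norm on $A$ with $\|x\|_A^2=xx^c$ for all $x\in Q_A$. For $E\subseteq\mathbb C$ let $\Omega_E=\{\alpha+\beta J\in Q_A:\alpha+i\beta\in E,\ J\in\mathbb S_A\}$; sets of this form are called *circular*. A *stem function* on a nonempty conjugation-invariant $D\subseteq\mathbb C$ is a map $F=F_1+\imath F_2:D\to A\otimes_{\mathbb R}\mathbb C$ with $F_1(\bar z)=F_1(z)$, $F_2(\bar z)=-F_2(z)$. A function $f:\Omega_D\to A$, with $\Omega_D$ open in $Q_A$, is *slice regular*, $f\in\mathcal{SR}(\Omega_D)$, if $f(\alpha+\beta J)=F_1(\alpha+i\beta)+JF_2(\alpha+i\beta)$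 for all $\alpha+i\beta\in D$, $J\in\mathbb S_A$, where $F$ is a $\mathscr C^1$ stem function with $\frac{\partial F}{\partial\alpha}+\imath\frac{\partial F}{\partial\beta}=0$ on $D$. Let $f\in\mathcal{SR}(\Omega)$ and $y\in\mathbb R$. The point $y$ is a *singularity* for $f$ if $\{x\in Q_A:0<\|x-y\|_A<R\}\subseteq\Omega$ for some $R>0$; then for some such $R$ there is an expansion $f(x)=\sum_{n\in\mathbb Z}(x-y)^na_n$ on this set (for real $y$ the slice product $(x-y)^{\bullet n}\cdot a_n$ is $(x-y)^na_n$). The *order* $\mathrm{ord}_f(y)\in\mathbb N\cup\{+\infty\}$ is the least $m\in\mathbb N$ with $a_{-k}=0$ for all $k>m$, and $+\infty$ if there is none. The singularity $y$ is a *pole* if such an $m$ exists and *essential* otherwise; it is *removable* if $f$ extends to a slice regular function on a circular open subset of $Q_A$ containing $y$. **Theorem.** Let $\widetilde\Omega$ be a circular open subset of $Q_A$, let $y\in\widetilde\Omega\cap\mathbb R$, set $\Omega=\widetilde\Omega\setminus\{y\}$, and let $f:\Omega\to A$ be slice regular. Then $y$ is a singularity for $f$, the sequence $(a_n)_{n\in\mathbb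 Z}$ above exists and is unique, and one of the following holds. 1. The point $y$ is a removable singularity for $f$. This is equivalent to each of: - (1a) $\mathrm{ord}_f(y)=0$; - (1b) there is a neighborhood $U$ of $y$ in $\widetilde\Omega$ such that $\|f\|_A$ is bounded in $U\setminus\{y\}$. 2. The point $y$ is a non-removable pole for $f$. This is equivalent to each of: - (2a) $\mathrm{ord}_f(y)$ is finite and positive; - (2b) there is $k\in\mathbb N\setminus\{0\}$ such that $x\mapsto(x-y)^kf(x)$ on $\Omega$ extends to some $g\in\mathcal{SR}(\widetilde\Omega)$ with $g(y)\neq0$. Moreover, for every $k$ and $g$ as in (2b), $k=\mathrm{ord}_f(y)$ and $\lim_{\Omega\ni x\to y}\|f(x)\|_A=+\infty$. 3. The point $y$ is an essential singularity for $f$. This is equivalent to each of: - (3a) $\mathrm{ord}_f(y)=+\infty$; - (3b) for all neighborhoods $U$ of $y$ in $\widetilde\Omega$ and all $k\in\mathbb N$, $\ \sup_{x\in U\setminus\{y\}}\|(x-y)^kf(x)\|_A=+\infty$. -/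

import Mathlib

open Filter Topology

/-- A (unital, not necessarily associative) alternative ring equipped with a norm inducing its
topology. No compatibility between the norm and the product is required here. -/
class NormedAlternativeRing (A : Type*) extends Norm A, NonAssocRing A, MetricSpace A where
  dist_eq : ∀ x y : A, dist x y = norm (-x + y)
  left_alternative : ∀ x y : A, associator x x y = 0
  right_alternative : ∀ x y : A, associator y x x = 0

instance NormedAlternativeRing.toNormedAddCommGroup {A : Type*} [h : NormedAlternativeRing A] :
    NormedAddCommGroup A :=
  { h with dist_eq := h.dist_eq }

namespace SliceRegular

section Basic

variable {A : Type*} [NormedAlternativeRing A] [NormedSpace ℝ A]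

/-- `x ^ k` for a natural exponent (the product of `A` need not be associative, but it is
power-associative, so the bracketing is irrelevant). -/
def pow (x : A) : ℕ → A
  | 0 => 1
  | k + 1 => x * pow x k

/-- The element `α + β J` of `A`, where `z = α + β i`. -/
def sliceEmb (J : A) (z : ℂ) : A := z.re • (1 : A) + z.im • J

variable [StarRing A]

variable (A) in
/-- The set `𝕊_A` of the `x` with trace `x + xᶜ = 0` and norm `x xᶜ = 1`. -/
def imagUnits : Set A := {x | x + star x = 0 ∧ x * star x = 1}

variable (A) in
/-- The quadratic cone `Q_A`. -/
def quadraticCone : Set A :=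
  Set.range (fun r : ℝ => r • (1 : A)) ∪
    {x | ∃ t n : ℝ, x + star x = t • (1 : A) ∧ x * star x = n • (1 : A) ∧ t ^ 2 < 4 * n}

/-- The circularization `Ω_E` of a set `E` of complex numbers. -/
def circularization (A : Type*) [NormedAlternativeRing A] [NormedSpace ℝ A] [StarRing A]
    (E : Set ℂ) : Set A :=
  {x | x ∈ quadraticCone A ∧ ∃ z ∈ E, ∃ J ∈ imagUnits A, x = sliceEmb J z}

/-- Circular subsets of the quadratic cone. -/
def IsCircular (Ω : Set A) : Prop := ∃ E : Set ℂ, Ω = circularization A E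

/-- `Ω` is a subset of the quadratic cone, open in the relative topology. -/
def IsOpenInCone (Ω : Set A) : Prop := ∃ U : Set A, IsOpen U ∧ Ω = U ∩ quadraticCone A

/-! The complexified algebra `A_ℂ = A + ı A` is represented by pairs: `(p₁, p₂)` is `p₁ + ı p₂`. -/

/-- The product of the complexified algebra. -/
def cplxMul (p q : A × A) : A × A := (p.1 * q.1 - p.2 * q.2, p.1 * q.2 + p.2 * q.1)

/-- The inclusion of `ℂ ≃ ℝ + ı ℝ` in the complexified algebra. -/
def ofComplex (c : ℂ) : A × A := (c.re • (1 : A), c.im • (1 : A))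

/-- The value `p₁ + J p₂`. -/
def evalAt (J : A) (p : A × A) : A := p.1 + J * p.2

/-- `F : D → A_ℂ` is a stem function on `D`. -/
def IsStemOn (D : Set ℂ) (F : ℂ → A × A) : Prop :=
  ∀ z ∈ D, (F (star z)).1 = (F z).1 ∧ (F (star z)).2 = -(F z).2

/-- The slice function `f` on `Ω_D` is induced by `F`, i.e. `f (α + β J) = F₁ z + J F₂ z`. -/
def IsInducedOn (D : Set ℂ) (F : ℂ → A × A) (f : A → A) : Prop :=
  ∀ z ∈ D, ∀ J ∈ imagUnits A, f (sliceEmb J z) = evalAt J (F z)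

/-- The derivative `∂F/∂z̄ = (∂F/∂α + ı ∂F/∂β) / 2`. -/
noncomputable def dbar (F : ℂ → A × A) (z : ℂ) : A × A :=
  (1 / 2 : ℝ) •
    (fderiv ℝ F z 1 + cplxMul (0, 1) (fderiv ℝ F z Complex.I))

/-- `f` (restricted to `Ω`) is a slice regular function on `Ω = Ω_D`, with `Ω` open in the
quadratic cone: it is induced by a stem function of class `C¹` with vanishing `∂F/∂z̄`.
Values of `f` outside `Ω` are irrelevant. -/
def SliceRegularOn (f : A → A) (Ω : Set A) : Prop :=
  IsOpenInCone Ω ∧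
  ∃ D : Set ℂ, D.Nonempty ∧ (∀ z ∈ D, star z ∈ D) ∧ Ω = circularization A D ∧
    ∃ F : ℂ → A × A, IsStemOn D F ∧ IsInducedOn D F f ∧
      ContDiffOn ℝ 1 F D ∧ ∀ z ∈ D, dbar F z = 0

/-- For real `y`, the set `Σ(y, 0, R)` is the punctured ball of the quadratic cone. -/
def puncturedBall (y : ℝ) (R : ℝ) : Set A :=
  {x | x ∈ quadraticCone A ∧ 0 < ‖x - y • (1 : A)‖ ∧ ‖x - y • (1 : A)‖ < R}

/-- The value at `x = α + β J` of `(x - y)^{• n} · a`, where `•` and `·` denote the slice product.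
For real `y`, the slice function `(x - y)^{• n}` is induced by `(z - y) ^ n ∈ ℂ ≃ ℝ + ı ℝ`, and
the slice product corresponds to the product of stem functions in `A_ℂ`. -/
noncomputable def laurentTerm (y : ℝ) (n : ℤ) (a : A) (J : A) (z : ℂ) : A :=
  evalAt J (cplxMul (ofComplex ((z - (y : ℂ)) ^ n)) (a, 0))

/-- The real point `y` is a singularity for functions that are slice regular on `Ω`. -/
def IsSingularity (Ω : Set A) (y : ℝ) : Prop :=
  ∃ R : ℝ, 0 < R ∧ puncturedBall y R ⊆ Ω

/-- `f(x) = ∑_{n ∈ ℤ} (x - y)^{• n} · a_n` on some `Σ(y, 0, R) ⊆ Ω`, with `R > 0`. -/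
def HasLaurentExpansion (Ω : Set A) (f : A → A) (y : ℝ) (a : ℤ → A) : Prop :=
  ∃ R : ℝ, 0 < R ∧ (puncturedBall y R : Set A) ⊆ Ω ∧
    ∀ z : ℂ, ∀ J ∈ imagUnits A, sliceEmb J z ∈ (puncturedBall y R : Set A) →
      HasSum (fun n : ℤ => laurentTerm y n (a n) J z) (f (sliceEmb J z))

open Classical in
/-- The coefficients of the Laurent expansion of `f` at `y` (meaningful where there is one). -/
noncomputable def laurentCoeff (Ω : Set A) (f : A → A) (y : ℝ) : ℤ → A :=
  if h : ∃ a, HasLaurentExpansion Ω f y a then h.choose else 0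

/-- `y` is a pole for `f`. -/
def IsPole (Ω : Set A) (f : A → A) (y : ℝ) : Prop :=
  IsSingularity Ω y ∧ ∃ m : ℕ, ∀ k : ℕ, m < k → laurentCoeff Ω f y (-(k : ℤ)) = 0

/-- `ord_f(y)`: the least `m : ℕ` with `a_{-k} = 0` for all `k > m`; `+∞` if there is none. -/
noncomputable def order (Ω : Set A) (f : A → A) (y : ℝ) : ℕ∞ :=
  sInf ((fun m : ℕ => (m : ℕ∞)) ''
    {m : ℕ | ∀ k : ℕ, m < k → laurentCoeff Ω f y (-(k : ℤ)) = 0})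

/-- `y` is an essential singularity for `f`. -/
def IsEssentialSingularity (Ω : Set A) (f : A → A) (y : ℝ) : Prop :=
  IsSingularity Ω y ∧ ¬ IsPole Ω f y

/-- `y` is a removable singularity for `f : Ω → A`: `f` extends to a slice regular function on a
circular open set containing `y`. -/
def IsRemovableSingularity (Ω : Set A) (f : A → A) (y : ℝ) : Prop :=
  IsSingularity Ω y ∧ ∃ (Ω' : Set A) (g : A → A),
    Ω ⊆ Ω' ∧ y • (1 : A) ∈ Ω' ∧ SliceRegularOn g Ω' ∧ Set.EqOn g f Ω

end Basic

end SliceRegular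

/-! A slice regular function is governed by its stem function `F`. In coordinates on the
complexified algebra `F` is an ordinary holomorphic map into `ℂⁿ` (`contDiffOn_and_dbar_iff`), so
the theorem reduces to the classical theory of isolated singularities, once the two sides are
matched.

The dictionary rests on an imaginary unit `J`. As `J * J = -1` and the algebra is alternative, left
multiplication by `J` is a complex structure, hence `(x - y)^k f(x)` is induced by `(z - y)^k F(z)`
(`pow_sliceEmb_sub_mul_evalAt`). The value `F z` is a linear function of the values of `f` along `J`
and `-J` (`recover`), while `‖f‖ ≤ C ‖F‖` with `C` the same for all units (`exists_norm_evalAt_le`).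
The slice embeddings are isometric, so neighborhoods and bounds pass in both directions. Conjugation
symmetry of `F` forces its Laurent coefficients to lie in `A`; they are the coefficients of `f`.

The core is an equivalence for each `k`: the coefficients `a_{-n}` with `n > k` vanish, iff `(x -
y)^k f` is bounded near `y` (`principalPartBound_iff_exists_norm_le`), iff it extends to a slice
regular function; the extension takes the value `a_{-k}` at `y`. The case `k = 0` characterizes
removable singularities, the least positive `k` gives poles, and failure for every `k` gives
essential singularities. -/

namespace SliceRegular

/-! ### Laurent series of vector-valued holomorphic functions on a punctured disc -/

section Laurent

open Metric Complex

variable {E : Type*} [NormedAddCommGroup E] [NormedSpace ℂ E]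

/-- A dominated series of functions may be integrated termwise over a circle. -/
theorem hasSum_circleIntegral_of_dominated {ι : Type*} [Countable ι] {F : ι → ℂ → E} {f : ℂ → E}
    {c : ℂ} {r : ℝ} (hr : 0 ≤ r) {u : ι → ℝ} (hF : ∀ i, ContinuousOn (F i) (sphere c r))
    (hu : ∀ i, ∀ z ∈ sphere c r, ‖F i z‖ ≤ u i) (hs : Summable u)
    (h : ∀ z ∈ sphere c r, HasSum (fun i => F i z) (f z)) :
    HasSum (fun i => ∮ z in C(c, r), F i z) (∮ z in C(c, r), f z) := by
  refine intervalIntegral.hasSum_integral_of_dominated_convergence (fun i _ => r * u i) ?_ ?_ ?_ ?_ ?_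
  · intro i
    exact ((hF i).circleIntegrable hr).out.def'.aestronglyMeasurable
  · refine fun i => Filter.Eventually.of_forall fun θ _ => ?_
    rw [norm_smul]
    simp only [deriv_circleMap, norm_mul, norm_circleMap_zero, norm_I, mul_one, abs_of_nonneg hr]
    exact mul_le_mul_of_nonneg_left (hu i _ (circleMap_mem_sphere _ hr _)) hr
  · exact Filter.Eventually.of_forall fun θ _ => hs.mul_left r
  · simp
  · exact Filter.Eventually.of_forall fun θ _ =>
      (h _ (circleMap_mem_sphere _ hr _)).const_smul _

/-- The `n`-th Laurent coefficient of `g` at `c`, computed on the circle of radius `r`. -/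
noncomputable def circleCoeff (g : ℂ → E) (c : ℂ) (r : ℝ) (n : ℤ) : E :=
  (2 * Real.pi * I : ℂ)⁻¹ • ∮ z in C(c, r), (z - c) ^ (-n - 1) • g z

theorem continuousOn_sub_zpow {c : ℂ} (n : ℤ) {s : Set ℂ} (hs : c ∉ s) :
    ContinuousOn (fun z : ℂ => (z - c) ^ n) s := fun _ hz =>
  ((continuousAt_id.sub continuousAt_const).zpow₀ n
    (Or.inl (sub_ne_zero.2 (ne_of_mem_of_not_mem hz hs)))).continuousWithinAt

theorem notMem_sphere_center {c : ℂ} {r : ℝ} (hr : 0 < r) : c ∉ sphere c r := by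
  simp [hr.ne]

theorem differentiableAt_sub_zpow {c z : ℂ} (n : ℤ) (h : z ≠ c) :
    DifferentiableAt ℂ (fun z : ℂ => (z - c) ^ n) z :=
  (differentiableAt_id.sub_const c).zpow (Or.inl (sub_ne_zero.2 h))

/-- Contour deformation: the integrand is holomorphic on the annulus between the two circles. -/
theorem circleCoeff_eq_of_differentiableOn {g : ℂ → E} {c : ℂ} {R r s : ℝ}
    (hg : DifferentiableOn ℂ g (ball c R \ {c})) (hr : 0 < r) (hrs : r ≤ s) (hsR : s < R) (n : ℤ) :
    circleCoeff g c s n = circleCoeff g c r n := by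
  have hsub : closedBall c s \ ball c r ⊆ ball c R \ {c} := fun z hz =>
    ⟨lt_of_le_of_lt hz.1 hsR, fun h => hz.2 (by rw [Set.mem_singleton_iff.1 h]; simpa using hr)⟩
  have hopen : IsOpen (ball c R \ {c}) := isOpen_ball.sdiff isClosed_singleton
  unfold circleCoeff
  rw [circleIntegral_eq_of_differentiable_on_annulus_off_countable hr hrs Set.countable_empty]
  · exact (continuousOn_sub_zpow _ (fun h => h.2 (by simpa using hr))).smul (hg.continuousOn.mono hsub)
  · rintro z ⟨⟨hz1, hz2⟩, -⟩
    have hz : z ∈ ball c R \ {c} := hsub ⟨ball_subset_closedBall hz1, fun h => hz2 (ball_subset_closedBall h)⟩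
    exact (differentiableAt_sub_zpow _ hz.2).smul ((hg z hz).differentiableAt (hopen.mem_nhds hz))

/-- This index shift reduces a pole of order at most `k` to a removable singularity. -/
theorem circleCoeff_zpow_smul {g : ℂ → E} {c : ℂ} {r : ℝ} (hr : 0 < r) (k n : ℤ) :
    circleCoeff (fun z => (z - c) ^ k • g z) c r n = circleCoeff g c r (n - k) := by
  unfold circleCoeff
  rw [circleIntegral.integral_congr hr.le (fun z hz => ?_)]
  have : z - c ≠ 0 := sub_ne_zero.2 fun h => notMem_sphere_center hr (h ▸ hz)
  simp only
  rw [smul_smul, ← zpow_add₀ this]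
  congr 2; ring

/-- Cauchy's estimate on shrinking circles. For `n < -k` the leftover power `-n - 1 - k` is
nonnegative, so for radius `r < 1` the integrand is at most `M`; the length of the circle then gives
the bound `r * M`, which tends to `0`. -/
theorem circleCoeff_eq_zero_of_bounded {g : ℂ → E} {c : ℂ} {R ε M : ℝ} (hε : 0 < ε)
    (hg : DifferentiableOn ℂ g (ball c R \ {c})) (k : ℤ)
    (hM : ∀ z ∈ ball c ε \ {c}, ‖(z - c) ^ k • g z‖ ≤ M) {n : ℤ} (hn : n < -k) {s : ℝ}
    (hs : 0 < s) (hsR : s < R) : circleCoeff g c s n = 0 := by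
  have key : ∀ r : ℝ, 0 < r → r < min (min ε 1) s → ‖circleCoeff g c s n‖ ≤ r * M := by
    intro r hr hlt
    have h1 : r < ε := hlt.trans_le ((min_le_left _ _).trans (min_le_left _ _))
    have h2 : r < 1 := hlt.trans_le ((min_le_left _ _).trans (min_le_right _ _))
    have h3 : r < s := hlt.trans_le (min_le_right _ _)
    rw [circleCoeff_eq_of_differentiableOn hg hr h3.le hsR]
    refine circleIntegral.norm_two_pi_i_inv_smul_integral_le_of_norm_le_const hr.le fun z hz => ?_
    have hzc : z ≠ c := fun h => notMem_sphere_center hr (h ▸ hz)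
    have hz0 : z - c ≠ 0 := sub_ne_zero.2 hzc
    have hb := hM z ⟨by rw [mem_ball, mem_sphere.1 hz]; exact h1, hzc⟩
    have he : (z - c) ^ (-n - 1) • g z = (z - c) ^ (-n - 1 - k) • ((z - c) ^ k • g z) := by
      rw [smul_smul, ← zpow_add₀ hz0]; congr 2; ring
    rw [he, norm_smul]
    have hnz : ‖z - c‖ = r := by rw [← dist_eq_norm]; exact hz
    have : ‖(z - c) ^ (-n - 1 - k)‖ ≤ 1 := by
      rw [norm_zpow, hnz]
      obtain ⟨m, hm⟩ := Int.eq_ofNat_of_zero_le (show 0 ≤ -n - 1 - k by omega)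
      rw [hm, zpow_natCast]
      exact pow_le_one₀ hr.le h2.le
    exact (mul_le_of_le_one_left (norm_nonneg _) this).trans hb
  have hlim : Tendsto (fun r : ℝ => r * M) (𝓝[>] 0) (𝓝 0) := by
    have : Tendsto (fun r : ℝ => r * M) (𝓝 0) (𝓝 (0 * M)) := tendsto_id.mul_const M
    rw [zero_mul] at this
    exact this.mono_left nhdsWithin_le_nhds
  have hle : ‖circleCoeff g c s n‖ ≤ 0 := by
    refine ge_of_tendsto hlim ?_
    have hpos : 0 < min (min ε 1) s := lt_min (lt_min hε one_pos) hs
    filter_upwards [Ioo_mem_nhdsGT hpos] with r hr using key r hr.1 hr.2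
  exact norm_le_zero_iff.1 hle

/-- Expansion of the Cauchy kernel for `z` inside the circle. Only continuity on the circle enters,
so the sum is the Cauchy integral and not yet `g z`. -/
theorem hasSum_circleCoeff_nat {g : ℂ → E} {c : ℂ} {s : ℝ} {z : ℂ}
    (hg : ContinuousOn g (sphere c s)) (hzs : dist z c < s) :
    HasSum (fun n : ℕ => (z - c) ^ (n : ℤ) • circleCoeff g c s (n : ℤ))
      ((2 * Real.pi * I : ℂ)⁻¹ • ∮ w in C(c, s), (w - z)⁻¹ • g w) := by
  have hs : 0 < s := dist_nonneg.trans_lt hzs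
  have h1 := hasSum_cauchyPowerSeries_integral (w := z - c) (hg.circleIntegrable hs.le)
    (by rw [← dist_eq_norm]; exact hzs)
  rw [add_sub_cancel] at h1
  convert! h1 using 2 with n
  rw [cauchyPowerSeries, ContinuousMultilinearMap.mkPiRing_apply, circleCoeff, Fin.prod_const,
    zpow_natCast]
  congr 2
  refine circleIntegral.integral_congr hs.le fun w hw => ?_
  have hw0 : w - c ≠ 0 := sub_ne_zero.2 fun h => notMem_sphere_center hs (h ▸ hw)
  change _ = (w - c)⁻¹ ^ n • (w - c)⁻¹ • g w
  rw [smul_smul, sub_eq_add_neg (-(n : ℤ)), zpow_add₀ hw0, zpow_neg, zpow_natCast, zpow_neg_one,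
    inv_pow]

/-- For `z` outside the circle, `1 / (z - w)` is a geometric series in `(w - c) / (z - c)`. The
minus sign comes from passing to `(w - z)⁻¹`. -/
theorem hasSum_circleCoeff_neg {g : ℂ → E} {c : ℂ} {r : ℝ} {z : ℂ} (hr : 0 < r)
    (hg : ContinuousOn g (sphere c r)) (hrz : r < dist z c) :
    HasSum (fun n : ℕ => (z - c) ^ (-((n : ℤ) + 1)) • circleCoeff g c r (-((n : ℤ) + 1)))
      (-((2 * Real.pi * I : ℂ)⁻¹ • ∮ w in C(c, r), (w - z)⁻¹ • g w)) := by
  have hz : 0 < ‖z - c‖ := by rw [← dist_eq_norm]; exact hr.trans hrz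
  have hz0 : z - c ≠ 0 := norm_pos_iff.1 hz
  have hnorm : ∀ w ∈ sphere c r, ‖w - c‖ = r := fun w hw => by rw [← dist_eq_norm]; exact hw
  have hq : r / ‖z - c‖ < 1 := by rw [div_lt_one hz, ← dist_eq_norm]; exact hrz
  obtain ⟨M, hM⟩ := (isCompact_sphere c r).exists_bound_of_continuousOn hg
  have key := hasSum_circleIntegral_of_dominated (c := c) hr.le
    (F := fun (n : ℕ) w => ((z - c)⁻¹ * ((w - c) / (z - c)) ^ n) • g w)
    (f := fun w => (z - w)⁻¹ • g w) (u := fun n => ‖z - c‖⁻¹ * (r / ‖z - c‖) ^ n * M)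
    (fun n => ContinuousOn.smul (by fun_prop) hg)
    (fun n w hw => by
      rw [norm_smul, norm_mul, norm_pow, norm_div, norm_inv, hnorm w hw]
      exact mul_le_mul_of_nonneg_left (hM w hw) (by positivity))
    (((summable_geometric_of_lt_one (by positivity) hq).mul_left _).mul_right _)
    (fun w hw => by
      refine HasSum.smul_const ?_ _
      have h1 : ‖(w - c) / (z - c)‖ < 1 := by rw [norm_div, hnorm w hw]; exact hq
      convert! (hasSum_geometric_of_norm_lt_one h1).mul_left (z - c)⁻¹ using 1
      rw [← mul_inv, mul_sub, mul_div_cancel₀ _ hz0]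
      congr 1; ring)
  have hval : (∮ w in C(c, r), (z - w)⁻¹ • g w) = -∮ w in C(c, r), (w - z)⁻¹ • g w := by
    have := circleIntegral.integral_smul (-1 : ℂ) (fun w => (w - z)⁻¹ • g w) c r
    rw [neg_one_smul] at this
    rw [← this]
    refine circleIntegral.integral_congr hr.le fun w _ => ?_
    change _ = (-1 : ℂ) • (w - z)⁻¹ • g w
    rw [neg_one_smul, ← neg_smul, ← inv_neg, neg_sub]
  rw [hval] at key
  rw [← smul_neg]
  convert! key.const_smul (2 * Real.pi * I : ℂ)⁻¹ using 2 with n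
  rw [circleCoeff, smul_comm]
  congr 1
  rw [← circleIntegral.integral_smul]
  refine circleIntegral.integral_congr hr.le fun w hw => ?_
  change (z - c) ^ (-((n : ℤ) + 1)) • (w - c) ^ (-(-((n : ℤ) + 1)) - 1) • g w = _
  rw [smul_smul]
  congr 1
  rw [neg_neg, add_sub_cancel_right, zpow_natCast, div_pow, zpow_neg, zpow_add₀ hz0, zpow_one,
    zpow_natCast]
  field_simp

variable [CompleteSpace E]

/-- Uniqueness of the coefficients of a Laurent expansion. -/
theorem eq_circleCoeff_of_hasSum [FiniteDimensional ℂ E] {g : ℂ → E} {c : ℂ} {r : ℝ} (hr : 0 < r)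
    {a : ℤ → E} (h : ∀ z ∈ sphere c r, HasSum (fun n : ℤ => (z - c) ^ n • a n) (g z)) (m : ℤ) :
    a m = circleCoeff g c r m := by
  have hnorm : ∀ z ∈ sphere c r, ‖z - c‖ = r := fun z hz => by rw [← dist_eq_norm]; exact hz
  have hne : ∀ z ∈ sphere c r, z - c ≠ 0 := fun z hz =>
    sub_ne_zero.2 fun h => notMem_sphere_center hr (h ▸ hz)
  -- In finite dimension summability is absolute, so convergence at the single point `c + r` yields
  -- a dominating series for the whole circle.
  have hsum : Summable fun n : ℤ => r ^ n * ‖a n‖ := by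
    have hmem : c + r ∈ sphere c r := by simp [abs_of_pos hr]
    have h1 : Summable fun n : ℤ => ‖(c + r - c) ^ n • a n‖ := summable_norm_iff.2 (h _ hmem).summable
    refine h1.congr fun n => ?_
    rw [norm_smul, norm_zpow, hnorm _ hmem]
  have key := hasSum_circleIntegral_of_dominated (c := c) hr.le
    (F := fun n z => (z - c) ^ (-m - 1) • (z - c) ^ n • a n)
    (f := fun z => (z - c) ^ (-m - 1) • g z) (u := fun n => r ^ (-m - 1) * (r ^ n * ‖a n‖))
    (fun n => (continuousOn_sub_zpow _ (notMem_sphere_center hr)).smul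
      ((continuousOn_sub_zpow _ (notMem_sphere_center hr)).smul continuousOn_const))
    (fun n z hz => by simp only [norm_smul, norm_zpow, hnorm z hz]; exact le_rfl)
    (hsum.mul_left _) (fun z hz => (h z hz).const_smul _)
  have hterm : ∀ n : ℤ, (∮ z in C(c, r), (z - c) ^ (-m - 1) • (z - c) ^ n • a n) =
      if n = m then (2 * Real.pi * I : ℂ) • a m else 0 := by
    intro n
    have h1 : (∮ z in C(c, r), (z - c) ^ (-m - 1) • (z - c) ^ n • a n) =
        (∮ z in C(c, r), (z - c) ^ (n - m - 1)) • a n := by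
      rw [← circleIntegral.integral_smul_const]
      refine circleIntegral.integral_congr hr.le fun z hz => ?_
      rw [smul_smul, ← zpow_add₀ (hne z hz)]
      congr 2; ring
    rw [h1]
    split_ifs with hnm
    · subst hnm
      have : (fun z : ℂ => (z - c) ^ (n - n - 1)) = fun z => (z - c)⁻¹ := by
        funext z; simp
      rw [this, circleIntegral.integral_sub_center_inv _ hr.ne']
    · rw [circleIntegral.integral_sub_zpow_of_ne (by omega), zero_smul]
  simp only [hterm] at key
  have h2 := (hasSum_ite_eq m ((2 * Real.pi * I : ℂ) • a m)).unique key
  rw [circleCoeff, ← h2, smul_smul, inv_mul_cancel₀ two_pi_I_ne_zero, one_smul]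

/-- Cauchy's integral formula on an annulus. -/
theorem circleIntegral_sub_circleIntegral_eq {g : ℂ → E} {c : ℂ} {R r s : ℝ} {z : ℂ}
    (hg : DifferentiableOn ℂ g (ball c R \ {c})) (hr : 0 < r) (hsR : s < R)
    (hrz : r < dist z c) (hzs : dist z c < s) :
    (∮ w in C(c, s), (w - z)⁻¹ • g w) - (∮ w in C(c, r), (w - z)⁻¹ • g w) =
      (2 * Real.pi * I : ℂ) • g z := by
  have hs : 0 < s := hr.trans (hrz.trans hzs)
  have hopen : IsOpen (ball c R \ {c}) := isOpen_ball.sdiff isClosed_singleton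
  have hzmem : z ∈ ball c R \ {c} :=
    ⟨hzs.trans hsR, fun h => by rw [Set.mem_singleton_iff.1 h, dist_self] at hrz; linarith⟩
  have hsub : closedBall c s \ ball c r ⊆ ball c R \ {c} := fun z hz =>
    ⟨lt_of_le_of_lt hz.1 hsR, fun h => hz.2 (by rw [Set.mem_singleton_iff.1 h]; simpa using hr)⟩
  -- The difference quotient of `g` at `z` is holomorphic across `z`, so its integrals over the two
  -- circles agree; splitting it on each circle leaves the winding numbers `1` and `0` of the
  -- circles about `z`.
  have hd : DifferentiableOn ℂ (dslope g z) (ball c R \ {c}) :=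
    (differentiableOn_dslope (hopen.mem_nhds hzmem)).2 hg
  have hEq := circleIntegral_eq_of_differentiable_on_annulus_off_countable hr (hrz.trans hzs).le
    Set.countable_empty (hd.continuousOn.mono hsub) (fun w hw => by
      have hw' : w ∈ ball c R \ {c} :=
        hsub ⟨ball_subset_closedBall hw.1.1, fun h => hw.1.2 (ball_subset_closedBall h)⟩
      exact (hd w hw').differentiableAt (hopen.mem_nhds hw'))
  have hexp : ∀ t : ℝ, 0 < t → t < R → t ≠ dist z c → (∮ w in C(c, t), dslope g z w) =
      (∮ w in C(c, t), (w - z)⁻¹ • g w) - (∮ w in C(c, t), (w - z)⁻¹) • g z := by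
    intro t ht htR htz
    have hne : ∀ w ∈ sphere c t, w ≠ z := fun w hw h => htz (by rw [← h]; exact (mem_sphere.1 hw).symm)
    have hinv : ContinuousOn (fun w => (w - z)⁻¹) (sphere c t) :=
      (continuousOn_id.sub continuousOn_const).inv₀ fun w hw => sub_ne_zero.2 (hne w hw)
    rw [← circleIntegral.integral_smul_const, ← circleIntegral.integral_sub]
    · refine circleIntegral.integral_congr ht.le fun w hw => ?_
      rw [dslope_of_ne _ (hne w hw), slope, vsub_eq_sub, smul_sub]
    · refine (hinv.smul (hg.continuousOn.mono fun w hw => ⟨?_, ?_⟩)).circleIntegrable ht.le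
      · rw [mem_ball, mem_sphere.1 hw]; exact htR
      · exact fun h => notMem_sphere_center ht (Set.mem_singleton_iff.1 h ▸ hw)
    · exact (hinv.smul continuousOn_const).circleIntegrable ht.le
  rw [hexp s hs hsR hzs.ne', hexp r hr ((hrz.trans hzs).trans hsR) hrz.ne] at hEq
  have h1 : (∮ w in C(c, s), (w - z)⁻¹) = 2 * Real.pi * I :=
    circleIntegral.integral_sub_inv_of_mem_ball hzs
  have h2 : (∮ w in C(c, r), (w - z)⁻¹) = 0 := by
    refine circleIntegral_eq_zero_of_differentiable_on_off_countable hr.le Set.countable_empty ?_ ?_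
    · refine (continuousOn_id.sub continuousOn_const).inv₀ fun w hw => sub_ne_zero.2 fun h => ?_
      change w = z at h
      rw [← h] at hrz
      exact absurd (mem_closedBall.1 hw) (not_le.2 hrz)
    · rintro w ⟨hw, -⟩
      refine (differentiableAt_id.sub_const z).inv (sub_ne_zero.2 fun h => ?_)
      change w = z at h
      rw [← h] at hrz
      exact absurd (mem_ball.1 hw) (not_lt.2 hrz.le)
  rw [h1, h2, zero_smul, sub_zero] at hEq
  rw [← hEq]; abel

/-- Existence of the Laurent expansion on a punctured disc. -/
theorem hasSum_circleCoeff {g : ℂ → E} {c : ℂ} {R ρ : ℝ} {z : ℂ}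
    (hg : DifferentiableOn ℂ g (ball c R \ {c})) (hρ : 0 < ρ) (hρR : ρ < R)
    (hz : z ∈ ball c R \ {c}) :
    HasSum (fun n : ℤ => (z - c) ^ n • circleCoeff g c ρ n) (g z) := by
  have hzc : 0 < dist z c := dist_pos.2 hz.2
  -- The radii `r < |z - c| < s` depend on `z`; the coefficients do not, and are brought back to
  -- radius `ρ`.
  obtain ⟨r, hr, hrz⟩ := exists_between hzc
  obtain ⟨s, hzs, hsR⟩ := exists_between (mem_ball.1 hz.1)
  have hs : 0 < s := hzc.trans hzs
  have hcoef : ∀ t : ℝ, 0 < t → t < R → circleCoeff g c t = circleCoeff g c ρ := by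
    intro t ht htR
    funext n
    rcases le_total ρ t with h | h
    · exact circleCoeff_eq_of_differentiableOn hg hρ h htR n
    · exact (circleCoeff_eq_of_differentiableOn hg ht h hρR n).symm
  have hcont : ∀ t : ℝ, 0 < t → t < R → ContinuousOn g (sphere c t) := fun t ht htR =>
    hg.continuousOn.mono fun w hw => ⟨by rw [mem_ball, mem_sphere.1 hw]; exact htR,
      fun h => notMem_sphere_center ht (Set.mem_singleton_iff.1 h ▸ hw)⟩
  have hrR : r < R := hrz.trans (hzs.trans hsR)
  have hpos := hasSum_circleCoeff_nat (hcont s hs hsR) hzs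
  have hneg := hasSum_circleCoeff_neg hr (hcont r hr hrR) hrz
  rw [hcoef s hs hsR] at hpos
  rw [hcoef r hr hrR] at hneg
  have := HasSum.of_nat_of_neg_add_one (f := fun n : ℤ => (z - c) ^ n • circleCoeff g c ρ n)
    hpos hneg
  rwa [← sub_eq_add_neg, ← smul_sub, circleIntegral_sub_circleIntegral_eq hg hr hsR hrz hzs,
    smul_smul, inv_mul_cancel₀ two_pi_I_ne_zero, one_smul] at this

/-- If the Laurent coefficients of negative index vanish, the singularity is removable. -/
theorem exists_extension_of_circleCoeff_eq_zero {g : ℂ → E} {c : ℂ} {R ρ : ℝ}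
    (hg : DifferentiableOn ℂ g (ball c R \ {c})) (hρ : 0 < ρ) (hρR : ρ < R)
    (h0 : ∀ n : ℤ, n < 0 → circleCoeff g c ρ n = 0) :
    ∃ P : ℂ → E, DifferentiableOn ℂ P (ball c ρ) ∧ Set.EqOn P g (ball c ρ \ {c}) ∧
      P c = circleCoeff g c ρ 0 := by
  have hcont : ContinuousOn g (sphere c ρ) :=
    hg.continuousOn.mono fun w hw => ⟨by rw [mem_ball, mem_sphere.1 hw]; exact hρR,
      fun h => notMem_sphere_center hρ (Set.mem_singleton_iff.1 h ▸ hw)⟩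
  -- The extension is the Cauchy integral over the circle, analytic in the disc whatever `g` does at
  -- `c`.
  refine ⟨fun z => (2 * Real.pi * I : ℂ)⁻¹ • ∮ w in C(c, ρ), (w - z)⁻¹ • g w, ?_, ?_, ?_⟩
  · lift ρ to NNReal using hρ.le
    have := (hasFPowerSeriesOn_cauchy_integral (hcont.circleIntegrable hρ.le)
      (NNReal.coe_pos.1 hρ)).differentiableOn
    rwa [eball_coe] at this
  · intro z hz
    have h1 := hasSum_circleCoeff hg hρ hρR ⟨hz.1.trans hρR, hz.2⟩
    have h2 := hasSum_circleCoeff_nat hcont hz.1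
    have h3 : HasSum (fun n : ℕ => (z - c) ^ (-((n : ℤ) + 1)) • circleCoeff g c ρ (-((n : ℤ) + 1)))
        (0 : E) := by
      convert hasSum_zero (α := E) (β := ℕ) using 2 with n
      rw [h0 _ (by omega), smul_zero]
    have := HasSum.of_nat_of_neg_add_one (f := fun n : ℤ => (z - c) ^ n • circleCoeff g c ρ n) h2 h3
    rw [add_zero] at this
    exact this.unique h1
  · have h2 := hasSum_circleCoeff_nat (z := c) hcont (by simpa using hρ)
    refine h2.unique ?_
    convert hasSum_single (f := fun n : ℕ => (c - c) ^ (n : ℤ) • circleCoeff g c ρ (n : ℤ)) 0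
      (fun n hn => ?_) using 1
    · simp
    · simp [hn]

end Laurent
end SliceRegular

namespace SliceRegular

/-! ### Slice embeddings of the complex plane and evaluation of stem values -/

section Algebra

set_option linter.unusedSectionVars false

variable {A : Type*} [NormedAlternativeRing A] [NormedSpace ℝ A]

theorem left_alternative (x y : A) : x * (x * y) = x * x * y :=
  (sub_eq_zero.1 (NormedAlternativeRing.left_alternative x y)).symm

/-- A bilinear map in finite dimension is bounded; this replaces submultiplicativity, which the norm
need not satisfy. -/
theorem exists_norm_mul_le [IsScalarTower ℝ A A] [SMulCommClass ℝ A A] [FiniteDimensional ℝ A] :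
    ∃ C : ℝ, 0 < C ∧ ∀ x y : A, ‖x * y‖ ≤ C * ‖x‖ * ‖y‖ := by
  let B : A →ₗ[ℝ] A →L[ℝ] A :=
    (LinearMap.toContinuousLinearMap (𝕜 := ℝ) (E := A) (F' := A)).toLinearMap ∘ₗ LinearMap.mul ℝ A
  let B' : A →L[ℝ] A →L[ℝ] A := LinearMap.toContinuousLinearMap B
  refine ⟨‖B'‖ + 1, by positivity, fun x y => ?_⟩
  have : ‖x * y‖ ≤ ‖B'‖ * ‖x‖ * ‖y‖ := B'.le_opNorm₂ x y
  refine this.trans ?_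
  gcongr
  linarith

theorem sliceEmb_sub (J : A) (z w : ℂ) : sliceEmb J (z - w) = sliceEmb J z - sliceEmb J w := by
  simp only [sliceEmb, Complex.sub_re, Complex.sub_im, sub_smul]; abel

@[simp] theorem sliceEmb_ofReal (J : A) (r : ℝ) : sliceEmb J (r : ℂ) = r • (1 : A) := by
  simp [sliceEmb]

@[simp] theorem sliceEmb_one (J : A) : sliceEmb J 1 = 1 := by
  simp [sliceEmb]

theorem sliceEmb_neg (J : A) (z : ℂ) : sliceEmb (-J) z = sliceEmb J (star z) := by
  simp [sliceEmb]

variable [IsScalarTower ℝ A A] [SMulCommClass ℝ A A]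

/-- Alternativity turns `J * (J * b)` into `-b`, so `evalAt J` carries the complex structure of the
complexified algebra to left multiplication by `J`. -/
theorem sliceEmb_mul_evalAt {J : A} (hJ : J * J = -1) (c : ℂ) (p : A × A) :
    sliceEmb J c * evalAt J p = evalAt J (cplxMul (ofComplex c) p) := by
  have h : J * (J * p.2) = -p.2 := by rw [left_alternative, hJ, neg_mul, one_mul]
  simp only [sliceEmb, evalAt, cplxMul, ofComplex, add_mul, mul_add, smul_mul_assoc, one_mul,
    mul_smul_comm, h, smul_neg]
  abel

theorem sliceEmb_mul {J : A} (hJ : J * J = -1) (z w : ℂ) :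
    sliceEmb J (z * w) = sliceEmb J z * sliceEmb J w := by
  have h : ∀ c : ℂ, sliceEmb J c = evalAt J (ofComplex c) := fun c => by
    simp [sliceEmb, evalAt, ofComplex]
  rw [h w, sliceEmb_mul_evalAt hJ, h]
  congr 1
  ext <;> simp [cplxMul, ofComplex, sub_smul, add_smul, smul_smul, mul_comm]

theorem pow_sliceEmb {J : A} (hJ : J * J = -1) (z : ℂ) (k : ℕ) :
    pow (sliceEmb J z) k = sliceEmb J (z ^ k) := by
  induction k with
  | zero => simp [pow]
  | succ k ih => rw [pow, ih, ← sliceEmb_mul hJ, pow_succ']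

theorem pow_sliceEmb_sub_mul_evalAt {J : A} (hJ : J * J = -1) (z : ℂ) (y : ℝ) (k : ℕ) (p : A × A) :
    pow (sliceEmb J z - y • (1 : A)) k * evalAt J p =
      evalAt J (cplxMul (ofComplex ((z - y) ^ k)) p) := by
  rw [← sliceEmb_ofReal J, ← sliceEmb_sub, pow_sliceEmb hJ, sliceEmb_mul_evalAt hJ]

theorem evalAt_add_evalAt_neg (J : A) (p : A × A) : evalAt J p + evalAt (-J) p = (2 : ℝ) • p.1 := by
  simp only [evalAt, neg_mul, two_smul]; abel

/-- With `evalAt_add_evalAt_neg` this is the representation formula: the values at `J` and `-J`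
determine both components. -/
theorem mul_evalAt_neg_sub_evalAt {J : A} (hJ : J * J = -1) (p : A × A) :
    J * (evalAt (-J) p - evalAt J p) = (2 : ℝ) • p.2 := by
  have h : J * (J * p.2) = -p.2 := by rw [left_alternative, hJ, neg_mul, one_mul]
  simp only [evalAt, neg_mul, mul_sub, mul_add, mul_neg, h, two_smul]; abel

/-! ### The complexified algebra as `ℂⁿ`, and holomorphy of stem functions -/

section Coord

variable [FiniteDimensional ℝ A]

variable (A) in
/-- Coordinates identifying the complexified algebra with `ℂⁿ`. -/
noncomputable def cplxCoord : (A × A) ≃L[ℝ] (Fin (Module.finrank ℝ A) → ℂ) :=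
  LinearEquiv.toContinuousLinearEquiv
    { toFun := fun p i =>
        ⟨(Module.finBasis ℝ A).equivFun p.1 i, (Module.finBasis ℝ A).equivFun p.2 i⟩
      invFun := fun q => ((Module.finBasis ℝ A).equivFun.symm fun i => (q i).re,
        (Module.finBasis ℝ A).equivFun.symm fun i => (q i).im)
      left_inv := fun p => by simp
      right_inv := fun q => by
        funext i
        simp only [LinearEquiv.apply_symm_apply]
      map_add' := fun p q => by funext i; apply Complex.ext <;> simp
      map_smul' := fun r p => by funext i; apply Complex.ext <;> simp }

theorem cplxCoord_apply (p : A × A) (i : Fin (Module.finrank ℝ A)) :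
    cplxCoord A p i =
      ⟨(Module.finBasis ℝ A).equivFun p.1 i, (Module.finBasis ℝ A).equivFun p.2 i⟩ := rfl

theorem cplxCoord_cplxMul_ofComplex (c : ℂ) (p : A × A) :
    cplxCoord A (cplxMul (ofComplex c) p) = c • cplxCoord A p := by
  funext i
  apply Complex.ext <;> simp [cplxCoord_apply, cplxMul, ofComplex]

theorem cplxCoord_symm_smul (c : ℂ) (q : Fin (Module.finrank ℝ A) → ℂ) :
    (cplxCoord A).symm (c • q) = cplxMul (ofComplex c) ((cplxCoord A).symm q) := by
  rw [ContinuousLinearEquiv.symm_apply_eq, cplxCoord_cplxMul_ofComplex,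
    ContinuousLinearEquiv.apply_symm_apply]

theorem cplxCoord_conj (p : A × A) : cplxCoord A (p.1, -p.2) = star (cplxCoord A p) := by
  funext i
  apply Complex.ext <;> simp [cplxCoord_apply]

/-- The fixed points of conjugation form the real part `A`; this is what places Laurent coefficients
in `A`. -/
theorem cplxCoord_symm_snd_of_star_eq {q : Fin (Module.finrank ℝ A) → ℂ} (h : star q = q) :
    ((cplxCoord A).symm q).2 = 0 := by
  set p := (cplxCoord A).symm q with hp
  have hq : cplxCoord A p = q := by rw [hp, ContinuousLinearEquiv.apply_symm_apply]
  have h1 : (p.1, -p.2) = p := (cplxCoord A).injective (by rw [cplxCoord_conj, hq, h])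
  have h2 : -p.2 = p.2 := congrArg Prod.snd h1
  have h3 : (2 : ℝ) • p.2 = 0 := by rw [two_smul]; nth_rewrite 1 [← h2]; simp
  exact (smul_eq_zero.1 h3).resolve_left two_ne_zero

/-- In coordinates `ı` acts as the scalar `i`, so the equation is Cauchy–Riemann in the form `F'(i)
= i F'(1)`. -/
theorem dbar_eq_zero_iff {F : ℂ → A × A} {z : ℂ} (hF : DifferentiableAt ℝ F z) :
    dbar F z = 0 ↔ DifferentiableAt ℂ (cplxCoord A ∘ F) z := by
  rw [differentiableAt_complex_iff_differentiableAt_real, (cplxCoord A).comp_fderiv]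
  have hd : DifferentiableAt ℝ (cplxCoord A ∘ F) z := (cplxCoord A).differentiableAt.comp z hF
  have hI : ∀ p : A × A, cplxMul (0, 1) p = cplxMul (ofComplex Complex.I) p := fun p => by
    simp [ofComplex]
  have hII : ∀ p : A × A, cplxMul (0, 1) (cplxMul (0, 1) p) = -p := fun p => by
    ext <;> simp [cplxMul]
  simp only [hd, true_and, ContinuousLinearMap.comp_apply, ContinuousLinearEquiv.coe_coe,
    ← cplxCoord_cplxMul_ofComplex, EmbeddingLike.apply_eq_iff_eq, ← hI]
  rw [dbar, smul_eq_zero, or_iff_right (by norm_num)]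
  constructor
  · intro h
    rw [eq_neg_of_add_eq_zero_left h]
    have : ∀ p : A × A, cplxMul (0, 1) (-p) = - cplxMul (0, 1) p := fun p => by
      ext <;> simp [cplxMul]
    rw [this, hII, neg_neg]
  · intro h
    rw [h, hII, add_neg_cancel]

theorem contDiffOn_and_dbar_iff {F : ℂ → A × A} {D : Set ℂ} (hD : IsOpen D) :
    (ContDiffOn ℝ 1 F D ∧ ∀ z ∈ D, dbar F z = 0) ↔ DifferentiableOn ℂ (cplxCoord A ∘ F) D := by
  constructor
  · rintro ⟨h1, h2⟩ z hz
    exact ((dbar_eq_zero_iff (((h1.differentiableOn one_ne_zero) z hz).differentiableAt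
      (hD.mem_nhds hz))).1 (h2 z hz)).differentiableWithinAt
  · intro h
    have h1 : ContDiffOn ℝ 1 F D := by
      have h2 : ContDiffOn ℝ 1 (cplxCoord A ∘ F) D := (h.contDiffOn hD).restrict_scalars ℝ
      have h3 := (cplxCoord A).symm.contDiff.comp_contDiffOn h2
      refine h3.congr fun z _ => by simp
    refine ⟨h1, fun z hz => (dbar_eq_zero_iff (((h1.differentiableOn one_ne_zero) z
      hz).differentiableAt (hD.mem_nhds hz))).2 ((h z hz).differentiableAt (hD.mem_nhds hz))⟩

end Coord

/-! ### Imaginary units, the quadratic cone and circular sets -/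

section Star

variable [StarRing A]

theorem mul_self_of_mem_imagUnits {J : A} (hJ : J ∈ imagUnits A) : J * J = -1 := by
  have h : star J = -J := (neg_eq_of_add_eq_zero_right hJ.1).symm
  have := hJ.2
  rw [h, mul_neg] at this
  rw [← this, neg_neg]

theorem neg_mem_imagUnits {J : A} (hJ : J ∈ imagUnits A) : -J ∈ imagUnits A := by
  refine ⟨?_, ?_⟩
  · rw [star_neg, ← neg_add, hJ.1, neg_zero]
  · rw [star_neg, neg_mul_neg, hJ.2]

variable [StarModule ℝ A]

theorem star_sliceEmb {J : A} (hJ : J ∈ imagUnits A) (z : ℂ) :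
    star (sliceEmb J z) = sliceEmb J (star z) := by
  have h : star J = -J := (neg_eq_of_add_eq_zero_right hJ.1).symm
  simp [sliceEmb, h]

theorem sliceEmb_mul_star {J : A} (hJ : J ∈ imagUnits A) (z : ℂ) :
    sliceEmb J z * star (sliceEmb J z) = (‖z‖ ^ 2) • (1 : A) := by
  rw [star_sliceEmb hJ, ← sliceEmb_mul (mul_self_of_mem_imagUnits hJ), Complex.star_def,
    Complex.mul_conj, ← Complex.sq_norm, sliceEmb_ofReal]

theorem sliceEmb_add_star {J : A} (hJ : J ∈ imagUnits A) (z : ℂ) :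
    sliceEmb J z + star (sliceEmb J z) = (2 * z.re) • (1 : A) := by
  rw [star_sliceEmb hJ]
  simp only [sliceEmb, Complex.star_def, Complex.conj_re, Complex.conj_im, neg_smul, two_mul,
    add_smul]
  abel

theorem sliceEmb_mem_quadraticCone {J : A} (hJ : J ∈ imagUnits A) (z : ℂ) :
    sliceEmb J z ∈ quadraticCone A := by
  by_cases h : z.im = 0
  · exact Or.inl ⟨z.re, by simp [sliceEmb, h]⟩
  · refine Or.inr ⟨2 * z.re, ‖z‖ ^ 2, sliceEmb_add_star hJ z, sliceEmb_mul_star hJ z, ?_⟩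
    rw [Complex.sq_norm, Complex.normSq_apply]
    have := mul_self_pos.2 h
    nlinarith

variable [Nontrivial A]

theorem smul_one_injective : Function.Injective fun r : ℝ => r • (1 : A) :=
  smul_left_injective ℝ one_ne_zero

/-- Trace and norm recover `z.re` and `|z|`, hence `z` up to conjugation, independently of the unit.
-/
theorem sliceEmb_eq {J J' : A} (hJ : J ∈ imagUnits A) (hJ' : J' ∈ imagUnits A) {z w : ℂ}
    (h : sliceEmb J z = sliceEmb J' w) : z = w ∨ z = star w := by
  have h1 : (2 * z.re) • (1 : A) = (2 * w.re) • (1 : A) := by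
    rw [← sliceEmb_add_star hJ, ← sliceEmb_add_star hJ', h]
  have h2 : (‖z‖ ^ 2) • (1 : A) = (‖w‖ ^ 2) • (1 : A) := by
    rw [← sliceEmb_mul_star hJ, ← sliceEmb_mul_star hJ', h]
  have h3 : z.re = w.re := by have := smul_one_injective (A := A) h1; linarith
  have h4 := smul_one_injective (A := A) h2
  simp only [Complex.sq_norm, Complex.normSq_apply, h3] at h4
  have h5 : z.im * z.im = w.im * w.im := by linarith
  rcases mul_self_eq_mul_self_iff.1 h5 with h6 | h6
  · exact Or.inl (Complex.ext h3 h6)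
  · exact Or.inr (Complex.ext (by simpa using h3) (by simpa using h6))

theorem mem_circularization_iff {D : Set ℂ} (hD : ∀ z ∈ D, star z ∈ D) {J : A}
    (hJ : J ∈ imagUnits A) {z : ℂ} : sliceEmb J z ∈ circularization A D ↔ z ∈ D := by
  constructor
  · rintro ⟨-, w, hw, J', hJ', h⟩
    rcases sliceEmb_eq hJ hJ' h with rfl | rfl
    exacts [hw, hD _ hw]
  · exact fun hz => ⟨sliceEmb_mem_quadraticCone hJ z, z, hz, J, hJ, rfl⟩

/-- No symmetry of `E` is required: a conjugate representative is absorbed by replacing `J'` with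
`-J'`. -/
theorem sliceEmb_mem_circularization {E : Set ℂ} {J J' : A} (hJ : J ∈ imagUnits A)
    (hJ' : J' ∈ imagUnits A) {z : ℂ} (h : sliceEmb J z ∈ circularization A E) :
    sliceEmb J' z ∈ circularization A E := by
  obtain ⟨-, w, hw, J₁, hJ₁, h⟩ := h
  refine ⟨sliceEmb_mem_quadraticCone hJ' z, w, hw, ?_⟩
  rcases sliceEmb_eq hJ hJ₁ h with rfl | rfl
  · exact ⟨J', hJ', rfl⟩
  · exact ⟨-J', neg_mem_imagUnits hJ', (sliceEmb_neg _ _).symm⟩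

/-- A circular set is the circularization of its preimage under any slice embedding. -/
theorem IsCircular.eq_circularization {Ω : Set A} (h : IsCircular Ω) {J : A}
    (hJ : J ∈ imagUnits A) : Ω = circularization A (sliceEmb J ⁻¹' Ω) := by
  obtain ⟨E, rfl⟩ := h
  ext x
  constructor
  · rintro ⟨hx, z, hz, J', hJ', rfl⟩
    exact ⟨hx, z, ⟨sliceEmb_mem_quadraticCone hJ z, z, hz, J, hJ, rfl⟩, J', hJ', rfl⟩
  · rintro ⟨hx, z, hz, J', hJ', rfl⟩
    exact sliceEmb_mem_circularization hJ hJ' hz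

theorem IsCircular.sliceEmb_mem {Ω : Set A} (h : IsCircular Ω) {J J' : A} (hJ : J ∈ imagUnits A)
    (hJ' : J' ∈ imagUnits A) {z : ℂ} (hz : sliceEmb J z ∈ Ω) : sliceEmb J' z ∈ Ω := by
  obtain ⟨E, rfl⟩ := h
  exact sliceEmb_mem_circularization hJ hJ' hz

theorem IsCircular.star_mem {Ω : Set A} (h : IsCircular Ω) {J : A} (hJ : J ∈ imagUnits A) :
    ∀ z ∈ sliceEmb J ⁻¹' Ω, star z ∈ sliceEmb J ⁻¹' Ω := fun z hz => by
  have := h.sliceEmb_mem hJ (neg_mem_imagUnits hJ) hz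
  rwa [sliceEmb_neg] at this

omit [Nontrivial A] in
theorem continuous_sliceEmb (J : A) : Continuous (sliceEmb J) := by
  unfold sliceEmb
  exact (Complex.continuous_re.smul continuous_const).add
    (Complex.continuous_im.smul continuous_const)

theorem IsOpenInCone.isOpen_preimage {Ω : Set A} (h : IsOpenInCone Ω) {J : A}
    (hJ : J ∈ imagUnits A) : IsOpen (sliceEmb J ⁻¹' Ω) := by
  obtain ⟨U, hU, rfl⟩ := h
  have : sliceEmb J ⁻¹' (U ∩ quadraticCone A) = sliceEmb J ⁻¹' U := by
    ext z
    exact and_iff_left (sliceEmb_mem_quadraticCone hJ z)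
  rw [this]
  exact hU.preimage (continuous_sliceEmb J)

section Norm

variable (hnorm : ∀ x ∈ quadraticCone A, (‖x‖ ^ 2) • (1 : A) = x * star x)
include hnorm

theorem norm_sliceEmb {J : A} (hJ : J ∈ imagUnits A) (z : ℂ) : ‖sliceEmb J z‖ = ‖z‖ := by
  have h := (hnorm _ (sliceEmb_mem_quadraticCone hJ z)).trans (sliceEmb_mul_star hJ z)
  exact (sq_eq_sq₀ (norm_nonneg _) (norm_nonneg _)).1 (smul_one_injective (A := A) h)

theorem norm_sliceEmb_sub {J : A} (hJ : J ∈ imagUnits A) (z : ℂ) (y : ℝ) :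
    ‖sliceEmb J z - y • (1 : A)‖ = ‖z - y‖ := by
  rw [← sliceEmb_ofReal J, ← sliceEmb_sub, norm_sliceEmb hnorm hJ]

theorem sliceEmb_mem_puncturedBall_iff {J : A} (hJ : J ∈ imagUnits A) {z : ℂ} {y R : ℝ} :
    sliceEmb J z ∈ (puncturedBall y R : Set A) ↔ z ∈ Metric.ball (y : ℂ) R \ {(y : ℂ)} := by
  rw [puncturedBall, Set.mem_ofPred_eq, norm_sliceEmb_sub hnorm hJ]
  simp only [sliceEmb_mem_quadraticCone hJ, true_and, norm_pos_iff, sub_ne_zero, Set.mem_sdiff,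
    Metric.mem_ball, dist_eq_norm, Set.mem_singleton_iff]
  exact and_comm

theorem norm_of_mem_imagUnits {J : A} (hJ : J ∈ imagUnits A) : ‖J‖ = 1 := by
  have := norm_sliceEmb hnorm hJ Complex.I
  simpa [sliceEmb] using this

end Norm

end Star

end Algebra
end SliceRegular

namespace SliceRegular

/-! ### Transfer between slice regular functions and holomorphic stem functions -/

section Singularities

set_option linter.unusedSectionVars false

variable {A : Type*} [NormedAlternativeRing A] [NormedSpace ℝ A]
  [IsScalarTower ℝ A A] [SMulCommClass ℝ A A] [FiniteDimensional ℝ A]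

/-- `evalAt J` as a continuous linear map. -/
noncomputable def evalAtL (J : A) : A × A →L[ℝ] A :=
  LinearMap.toContinuousLinearMap
    { toFun := evalAt J
      map_add' := fun p q => by simp only [evalAt, Prod.fst_add, Prod.snd_add, mul_add]; abel
      map_smul' := fun r p => by simp [evalAt, mul_smul_comm] }

@[simp] theorem evalAtL_apply (J : A) (p : A × A) : evalAtL J p = evalAt J p := rfl

/-- The inverse of `p ↦ (evalAt J p, evalAt (-J) p)`. -/
noncomputable def recover (J : A) : A × A →L[ℝ] A × A :=
  LinearMap.toContinuousLinearMap
    { toFun := fun q => ((1 / 2 : ℝ) • (q.1 + q.2), (1 / 2 : ℝ) • (J * (q.2 - q.1)))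
      map_add' := fun p q => by
        ext
        · simp only [Prod.fst_add, Prod.snd_add, smul_add]; abel
        · simp only [Prod.fst_add, Prod.snd_add, smul_add, mul_sub, mul_add, smul_sub]; abel
      map_smul' := fun r p => by
        ext
        · simp only [Prod.smul_fst, Prod.smul_snd, ← smul_add, smul_comm r, RingHom.id_apply]
        · simp only [Prod.smul_fst, Prod.smul_snd, ← smul_sub, smul_comm r, RingHom.id_apply,
            mul_smul_comm] }

theorem recover_evalAt {J : A} (hJ : J * J = -1) (p : A × A) :
    recover J (evalAt J p, evalAt (-J) p) = p := by
  change ((1 / 2 : ℝ) • (evalAt J p + evalAt (-J) p),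
    (1 / 2 : ℝ) • (J * (evalAt (-J) p - evalAt J p))) = p
  rw [evalAt_add_evalAt_neg, mul_evalAt_neg_sub_evalAt hJ, smul_smul, smul_smul]
  norm_num

theorem norm_le_of_norm_evalAt_le {J : A} (hJ : J * J = -1) {p : A × A} {M : ℝ}
    (h1 : ‖evalAt J p‖ ≤ M) (h2 : ‖evalAt (-J) p‖ ≤ M) : ‖p‖ ≤ ‖recover J‖ * M := by
  calc ‖p‖ = ‖recover J (evalAt J p, evalAt (-J) p)‖ := by rw [recover_evalAt hJ]
    _ ≤ ‖recover J‖ * ‖(evalAt J p, evalAt (-J) p)‖ := (recover J).le_opNorm _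
    _ ≤ ‖recover J‖ * M := by
        gcongr
        exact max_le h1 h2

variable [StarRing A] [StarModule ℝ A] [Nontrivial A]

theorem SliceRegularOn.isCircular {f : A → A} {Ω : Set A} (hf : SliceRegularOn f Ω) :
    IsCircular Ω := by
  obtain ⟨-, D, -, -, h, -⟩ := hf
  exact ⟨D, h⟩

/-- A slice regular function is induced by a holomorphic stem function. -/
theorem SliceRegularOn.exists_stem {f : A → A} {Ω : Set A} (hf : SliceRegularOn f Ω) {J : A}
    (hJ : J ∈ imagUnits A) :
    ∃ F : ℂ → A × A, IsStemOn (sliceEmb J ⁻¹' Ω) F ∧ IsInducedOn (sliceEmb J ⁻¹' Ω) F f ∧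
      DifferentiableOn ℂ (cplxCoord A ∘ F) (sliceEmb J ⁻¹' Ω) := by
  obtain ⟨hopen, D, -, hstar, rfl, F, h1, h2, h3, h4⟩ := hf
  have hD : sliceEmb J ⁻¹' circularization A D = D := by
    ext z
    exact mem_circularization_iff hstar hJ
  have hDo := hopen.isOpen_preimage hJ
  rw [hD] at hDo ⊢
  exact ⟨F, h1, h2, (contDiffOn_and_dbar_iff hDo).1 ⟨h3, h4⟩⟩

theorem sliceRegularOn_of_stem {f : A → A} {Ω : Set A} (hcirc : IsCircular Ω)
    (hopen : IsOpenInCone Ω) {J : A} (hJ : J ∈ imagUnits A) (hne : (sliceEmb J ⁻¹' Ω).Nonempty)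
    {F : ℂ → A × A} (h1 : IsStemOn (sliceEmb J ⁻¹' Ω) F) (h2 : IsInducedOn (sliceEmb J ⁻¹' Ω) F f)
    (h3 : DifferentiableOn ℂ (cplxCoord A ∘ F) (sliceEmb J ⁻¹' Ω)) : SliceRegularOn f Ω := by
  obtain ⟨h4, h5⟩ := (contDiffOn_and_dbar_iff (hopen.isOpen_preimage hJ)).2 h3
  exact ⟨hopen, _, hne, hcirc.star_mem hJ, hcirc.eq_circularization hJ, F, h1, h2, h4, h5⟩

theorem exists_eq_sliceEmb {Ω : Set A} (hcirc : IsCircular Ω) {J : A} (hJ : J ∈ imagUnits A)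
    {x : A} (hx : x ∈ Ω) : ∃ z ∈ sliceEmb J ⁻¹' Ω, ∃ J' ∈ imagUnits A, x = sliceEmb J' z := by
  rw [hcirc.eq_circularization hJ] at hx
  exact hx.2

theorem sliceEmb_eq_smul_one_iff {J : A} (hJ : J ∈ imagUnits A) {z : ℂ} {y : ℝ} :
    sliceEmb J z = y • (1 : A) ↔ z = y := by
  constructor
  · intro h
    rw [← sliceEmb_ofReal J] at h
    rcases sliceEmb_eq hJ hJ h with h | h
    · exact h
    · simpa using h
  · rintro rfl
    exact sliceEmb_ofReal J y

theorem preimage_sliceEmb_diff {J : A} (hJ : J ∈ imagUnits A) (Ω : Set A) (y : ℝ) :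
    sliceEmb J ⁻¹' (Ω \ {y • (1 : A)}) = (sliceEmb J ⁻¹' Ω) \ {(y : ℂ)} := by
  ext z
  simp [sliceEmb_eq_smul_one_iff hJ]

theorem isStemOn_iff {D : Set ℂ} {F : ℂ → A × A} :
    IsStemOn D F ↔ ∀ z ∈ D, cplxCoord A (F (star z)) = star (cplxCoord A (F z)) := by
  refine forall₂_congr fun z _ => ?_
  rw [← cplxCoord_conj, EmbeddingLike.apply_eq_iff_eq, Prod.ext_iff]

section Norm

variable (hnorm : ∀ x ∈ quadraticCone A, (‖x‖ ^ 2) • (1 : A) = x * star x)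
include hnorm

theorem exists_norm_evalAt_le :
    ∃ C : ℝ, 0 < C ∧ ∀ J ∈ imagUnits A, ∀ p : A × A, ‖evalAt J p‖ ≤ C * ‖p‖ := by
  obtain ⟨C, hC, h⟩ := exists_norm_mul_le (A := A)
  refine ⟨1 + C, by linarith, fun J hJ p => ?_⟩
  have h1 := h J p.2
  rw [norm_of_mem_imagUnits hnorm hJ, mul_one] at h1
  have h2 : ‖p.1‖ ≤ ‖p‖ := norm_fst_le p
  have h3 : C * ‖p.2‖ ≤ C * ‖p‖ := mul_le_mul_of_nonneg_left (norm_snd_le p) hC.le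
  calc ‖evalAt J p‖ ≤ ‖p.1‖ + ‖J * p.2‖ := norm_add_le _ _
    _ ≤ (1 + C) * ‖p‖ := by linarith

/-- Slice regular functions are continuous at real points. -/
theorem SliceRegularOn.tendsto_nhdsWithin {g : A → A} {Ω : Set A} (hg : SliceRegularOn g Ω)
    (hS : (imagUnits A).Nonempty) {y : ℝ} (hy : y • (1 : A) ∈ Ω) :
    Tendsto g (𝓝[Ω] (y • (1 : A))) (𝓝 (g (y • (1 : A)))) := by
  obtain ⟨J, hJ⟩ := hS
  obtain ⟨F, -, h2, h3⟩ := hg.exists_stem hJ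
  obtain ⟨C, hC, hCb⟩ := exists_norm_evalAt_le hnorm
  have hDo : IsOpen (sliceEmb J ⁻¹' Ω) := hg.1.isOpen_preimage hJ
  have hyD : (y : ℂ) ∈ sliceEmb J ⁻¹' Ω := by simpa using hy
  have hcont : ContinuousAt F y := by
    have h4 := (h3 _ hyD).continuousWithinAt.continuousAt (hDo.mem_nhds hyD)
    have h5 := (cplxCoord A).symm.continuous.continuousAt.comp h4
    refine h5.congr (Eventually.of_forall fun z => by simp)
  rw [Metric.tendsto_nhdsWithin_nhds]
  intro ε hε
  obtain ⟨δ, hδ, hδF⟩ := Metric.continuousAt_iff.1 hcont (ε / C) (div_pos hε hC)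
  refine ⟨δ, hδ, fun {x} hx hxy => ?_⟩
  obtain ⟨z, hz, J', hJ', rfl⟩ := exists_eq_sliceEmb hg.isCircular hJ hx
  rw [dist_eq_norm, norm_sliceEmb_sub hnorm hJ', ← dist_eq_norm] at hxy
  -- The choice of `δ` is uniform over the units, since `C` does not depend on `J'`.
  have h6 := hδF hxy
  have h7 := h2 _ hyD J' hJ'
  rw [sliceEmb_ofReal] at h7
  rw [h2 z hz J' hJ', h7, dist_eq_norm]
  have h8 : evalAt J' (F z) - evalAt J' (F y) = evalAt J' (F z - F y) :=
    (map_sub (evalAtL J') _ _).symm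
  rw [h8]
  refine (hCb J' hJ' _).trans_lt ?_
  rw [dist_eq_norm, lt_div_iff₀ hC] at h6
  linarith

/-- A relative neighborhood of a real point contains the images of a disc. -/
theorem exists_ball_of_mem_nhdsWithin {Ω U : Set A} {y : ℝ} (hU : U ∈ 𝓝[Ω] (y • (1 : A))) :
    ∃ ε > 0, ∀ z : ℂ, ∀ J ∈ imagUnits A, z ∈ Metric.ball (y : ℂ) ε → sliceEmb J z ∈ Ω →
      sliceEmb J z ∈ U := by
  obtain ⟨ε, hε, h⟩ := Metric.mem_nhdsWithin_iff.1 hU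
  refine ⟨ε, hε, fun z J hJ hz hzΩ => h ⟨?_, hzΩ⟩⟩
  rw [Metric.mem_ball, dist_eq_norm] at hz ⊢
  rwa [norm_sliceEmb_sub hnorm hJ]

variable {J : A} (hJ : J ∈ imagUnits A) {Ω : Set A} {f : A → A} {y R : ℝ}
  {F : ℂ → A × A} (hR : 0 < R)
  (hball : Metric.ball (y : ℂ) R \ {(y : ℂ)} ⊆ sliceEmb J ⁻¹' Ω)
  (hind : IsInducedOn (sliceEmb J ⁻¹' Ω) F f)
  (hdiff : DifferentiableOn ℂ (cplxCoord A ∘ F) (Metric.ball (y : ℂ) R \ {(y : ℂ)}))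
include hJ hR hball hind hdiff

/-- The coefficients of any Laurent expansion are those of the stem function. -/
theorem HasLaurentExpansion.cplxCoord_eq {a : ℤ → A} (ha : HasLaurentExpansion Ω f y a) {ρ : ℝ}
    (hρ : 0 < ρ) (hρR : ρ < R) (n : ℤ) :
    cplxCoord A (a n, 0) = circleCoeff (cplxCoord A ∘ F) y ρ n := by
  obtain ⟨R', hR', -, hsum⟩ := ha
  obtain ⟨r, hr, hrlt⟩ := exists_between (lt_min hR' hρ)
  have hrR' : r < R' := hrlt.trans_le (min_le_left _ _)
  have hrρ : r < ρ := hrlt.trans_le (min_le_right _ _)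
  rw [circleCoeff_eq_of_differentiableOn hdiff hr hrρ.le hρR]
  refine eq_circleCoeff_of_hasSum hr (a := fun n => cplxCoord A (a n, 0)) (fun z hz => ?_) n
  have hzne : z ≠ y := fun h => notMem_sphere_center hr (h ▸ hz)
  have hz' : z ∈ Metric.ball (y : ℂ) R' \ {(y : ℂ)} :=
    ⟨by rw [Metric.mem_ball, Metric.mem_sphere.1 hz]; exact hrR', hzne⟩
  have hzD : z ∈ sliceEmb J ⁻¹' Ω :=
    hball ⟨by rw [Metric.mem_ball, Metric.mem_sphere.1 hz]; exact hrρ.trans hρR, hzne⟩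
  have hterm : ∀ K ∈ imagUnits A, HasSum (fun n : ℤ => evalAt K (cplxMul
      (ofComplex ((z - (y : ℂ)) ^ n)) (a n, 0))) (evalAt K (F z)) := fun K hK => by
    have := hsum z K hK ((sliceEmb_mem_puncturedBall_iff hnorm hK).2 hz')
    rw [hind z hzD K hK] at this
    exact this
  -- The expansions along `J` and `-J` together give, through `recover`, an expansion of the stem
  -- function, to which uniqueness applies.
  have h1 := ((hterm J hJ).prodMk (hterm (-J) (neg_mem_imagUnits hJ))).mapL (recover J)
  simp only [recover_evalAt (mul_self_of_mem_imagUnits hJ)] at h1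
  have h2 := h1.mapL (cplxCoord A).toContinuousLinearMap
  simp only [ContinuousLinearEquiv.coe_coe, cplxCoord_cplxMul_ofComplex] at h2
  exact h2

omit hnorm hJ hball hind in
-- Conjugating the expansion at `star z` gives another expansion at `z` of the same function, so
-- uniqueness forces the coefficients to be fixed.
theorem star_circleCoeff (hstar : ∀ z ∈ Metric.ball (y : ℂ) R \ {(y : ℂ)},
      cplxCoord A (F (star z)) = star (cplxCoord A (F z))) {ρ : ℝ} (hρ : 0 < ρ) (hρR : ρ < R)
    (n : ℤ) : star (circleCoeff (cplxCoord A ∘ F) y ρ n) = circleCoeff (cplxCoord A ∘ F) y ρ n := by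
  refine eq_circleCoeff_of_hasSum hρ
    (a := fun n => star (circleCoeff (cplxCoord A ∘ F) y ρ n)) (fun z hz => ?_) n
  have hzne : z ≠ y := fun h => notMem_sphere_center hρ (h ▸ hz)
  have hsy : star z - y = star (z - y) := by simp
  have hw : star z ∈ Metric.ball (y : ℂ) R \ {(y : ℂ)} := by
    refine ⟨?_, fun h => hzne ?_⟩
    · rw [Metric.mem_ball, dist_eq_norm, hsy, norm_star, ← dist_eq_norm, Metric.mem_sphere.1 hz]
      exact hρR
    · rw [Set.mem_singleton_iff, ← sub_eq_zero, hsy, star_eq_zero, sub_eq_zero] at h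
      exact h
  have h1 := (hasSum_circleCoeff hdiff hρ hρR hw).star
  have h2 := hstar _ hw
  rw [star_star] at h2
  simp only [Function.comp_apply, ← h2, hsy, star_smul, star_zpow₀, star_star] at h1
  exact h1

/-- Apply `evalAt K` termwise to the Laurent series of the stem function; by `star_circleCoeff` its
coefficients have the form `(a, 0)`. -/
theorem hasLaurentExpansion_of_stem (hstar : ∀ z ∈ Metric.ball (y : ℂ) R \ {(y : ℂ)},
      cplxCoord A (F (star z)) = star (cplxCoord A (F z)))
    (hsub : (puncturedBall y R : Set A) ⊆ Ω) {ρ : ℝ} (hρ : 0 < ρ) (hρR : ρ < R) :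
    HasLaurentExpansion Ω f y
      fun n => ((cplxCoord A).symm (circleCoeff (cplxCoord A ∘ F) y ρ n)).1 := by
  refine ⟨R, hR, hsub, fun z K hK hz => ?_⟩
  have hz' := (sliceEmb_mem_puncturedBall_iff hnorm hK).1 hz
  have h1 := ((hasSum_circleCoeff hdiff hρ hρR hz').mapL
    (cplxCoord A).symm.toContinuousLinearMap).mapL (evalAtL K)
  simp only [ContinuousLinearEquiv.coe_coe, Function.comp_apply,
    ContinuousLinearEquiv.symm_apply_apply, evalAtL_apply, cplxCoord_symm_smul] at h1
  rw [hind z (hball hz') K hK]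
  convert h1 using 2 with n
  rw [laurentTerm]
  congr 2
  ext
  · rfl
  · exact (cplxCoord_symm_snd_of_star_eq (star_circleCoeff hR hdiff hstar hρ hρR n)).symm

/-- A bound for `(x - y) ^ k * f x` kills the coefficients of index less than `-k`. -/
theorem circleCoeff_eq_zero_of_norm_le {ε M : ℝ} (hε : 0 < ε) (k : ℕ)
    (hM : ∀ z ∈ Metric.ball (y : ℂ) ε, z ≠ y → ∀ K ∈ imagUnits A, sliceEmb K z ∈ Ω →
      ‖pow (sliceEmb K z - y • (1 : A)) k * f (sliceEmb K z)‖ ≤ M) {ρ : ℝ}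
    (hρ : 0 < ρ) (hρR : ρ < R) (hcirc : IsCircular Ω) {n : ℕ} (hn : k < n) :
    circleCoeff (cplxCoord A ∘ F) y ρ (-(n : ℤ)) = 0 := by
  have hJJ := mul_self_of_mem_imagUnits hJ
  refine circleCoeff_eq_zero_of_bounded (lt_min hε hR) hdiff k
    (M := ‖(cplxCoord A).toContinuousLinearMap‖ * (‖recover J‖ * M)) (fun z hz => ?_) (by omega) hρ hρR
  have hzε : z ∈ Metric.ball (y : ℂ) ε := Metric.ball_subset_ball (min_le_left _ _) hz.1
  have hzD : z ∈ sliceEmb J ⁻¹' Ω :=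
    hball ⟨Metric.ball_subset_ball (min_le_right _ _) hz.1, hz.2⟩
  have hbd : ∀ K ∈ imagUnits A,
      ‖evalAt K (cplxMul (ofComplex ((z - (y : ℂ)) ^ k)) (F z))‖ ≤ M := fun K hK => by
    have := hM z hzε hz.2 K hK (hcirc.sliceEmb_mem hJ hK hzD)
    rwa [hind z hzD K hK, pow_sliceEmb_sub_mul_evalAt (mul_self_of_mem_imagUnits hK)] at this
  rw [Function.comp_apply, ← cplxCoord_cplxMul_ofComplex, zpow_natCast]
  refine ((cplxCoord A).toContinuousLinearMap.le_opNorm _).trans ?_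
  gcongr
  exact norm_le_of_norm_evalAt_le hJJ (hbd J hJ) (hbd (-J) (neg_mem_imagUnits hJ))

end Norm

end Singularities

end SliceRegular

namespace SliceRegular

/-! ### The order as a bound on the principal part -/

section Order

set_option linter.unusedSectionVars false

variable {A : Type*} [NormedAlternativeRing A] [NormedSpace ℝ A] [StarRing A]

/-- The Laurent coefficients at `y` of index less than `-k` vanish. -/
def PrincipalPartBound (Ω : Set A) (f : A → A) (y : ℝ) (k : ℕ) : Prop :=
  ∀ n : ℕ, k < n → laurentCoeff Ω f y (-(n : ℤ)) = 0

/-- The infimum of the empty set in `ℕ∞` is `⊤`. -/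
theorem order_eq_top_iff {Ω : Set A} {f : A → A} {y : ℝ} :
    order Ω f y = ⊤ ↔ ∀ k, ¬ PrincipalPartBound Ω f y k := by
  rw [order, sInf_eq_top]
  constructor
  · exact fun h k hk => ENat.natCast_ne_top k (h _ ⟨k, hk, rfl⟩)
  · rintro h _ ⟨k, hk, rfl⟩
    exact absurd hk (h k)

theorem order_eq_of_isLeast {Ω : Set A} {f : A → A} {y : ℝ} {k : ℕ}
    (h : IsLeast {m | PrincipalPartBound Ω f y m} k) : order Ω f y = k :=
  (Monotone.map_isLeast (f := fun m : ℕ => (m : ℕ∞)) Nat.mono_cast h).csInf_eq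

theorem order_eq_zero_iff {Ω : Set A} {f : A → A} {y : ℝ} :
    order Ω f y = 0 ↔ PrincipalPartBound Ω f y 0 := by
  classical
  constructor
  · intro h
    have hex : ∃ k, PrincipalPartBound Ω f y k := by
      by_contra! hne
      rw [order_eq_top_iff.2 hne] at h
      exact ENat.top_ne_zero h
    have h1 := order_eq_of_isLeast (k := Nat.find hex)
      ⟨Nat.find_spec hex, fun m hm => Nat.find_min' hex hm⟩
    rw [h] at h1
    have h2 : Nat.find hex = 0 := by exact_mod_cast h1.symm
    exact h2 ▸ Nat.find_spec hex
  · exact fun h => order_eq_of_isLeast (k := 0) ⟨h, fun _ _ => Nat.zero_le _⟩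

theorem order_eq_of_laurentCoeff_ne_zero {Ω : Set A} {f : A → A} {y : ℝ} {k : ℕ}
    (h : PrincipalPartBound Ω f y k) (hne : laurentCoeff Ω f y (-(k : ℤ)) ≠ 0) :
    order Ω f y = k :=
  order_eq_of_isLeast ⟨h, fun _ hm => not_lt.1 fun hlt => hne (hm k hlt)⟩

theorem exists_principalPartBound_of_order {Ω : Set A} {f : A → A} {y : ℝ}
    (h1 : order Ω f y ≠ ⊤) (h2 : order Ω f y ≠ 0) :
    ∃ k ≠ 0, PrincipalPartBound Ω f y k ∧ laurentCoeff Ω f y (-(k : ℤ)) ≠ 0 := by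
  classical
  rw [Ne, order_eq_top_iff] at h1
  push Not at h1
  have h0 : Nat.find h1 ≠ 0 := fun h => h2 (order_eq_zero_iff.2 (h ▸ Nat.find_spec h1))
  refine ⟨Nat.find h1, h0, Nat.find_spec h1, fun h => ?_⟩
  -- If the coefficient of index `-k` vanished as well, `k - 1` would be a smaller bound.
  refine Nat.find_min h1 (Nat.sub_one_lt h0) fun n hn => ?_
  rcases eq_or_lt_of_le (show Nat.find h1 ≤ n by omega) with h3 | h3
  · rw [← h3]; exact h
  · exact Nat.find_spec h1 n h3

end Order

/-! ### Bounds, extensions and principal parts at a real point -/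

section Main

set_option linter.unusedSectionVars false

variable {A : Type*} [NormedAlternativeRing A] [NormedSpace ℝ A]
  [IsScalarTower ℝ A A] [SMulCommClass ℝ A A] [FiniteDimensional ℝ A]
  [StarRing A] [StarModule ℝ A] [Nontrivial A]
  (hS : (imagUnits A).Nonempty)
  (hnorm : ∀ x ∈ quadraticCone A, (‖x‖ ^ 2) • (1 : A) = x * star x)
  {Ωt : Set A} (hcirc : IsCircular Ωt) (hopen : IsOpenInCone Ωt)
  {y : ℝ} (hy : y • (1 : A) ∈ Ωt)
  {f : A → A} (hf : SliceRegularOn f (Ωt \ {y • (1 : A)}))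

omit [IsScalarTower ℝ A A] [SMulCommClass ℝ A A] [FiniteDimensional ℝ A] [StarModule ℝ A]
  [Nontrivial A] in
include hopen hy in
theorem exists_puncturedBall_subset :
    ∃ R : ℝ, 0 < R ∧ (puncturedBall y R : Set A) ⊆ Ωt \ {y • (1 : A)} := by
  obtain ⟨U, hU, rfl⟩ := hopen
  obtain ⟨R, hR, h⟩ := Metric.isOpen_iff.1 hU _ hy.1
  refine ⟨R, hR, fun x hx => ⟨⟨h ?_, hx.1⟩, fun h0 => ?_⟩⟩
  · rw [Metric.mem_ball, dist_eq_norm]; exact hx.2.2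
  · have := hx.2.1
    rw [Set.mem_singleton_iff.1 h0, sub_self, norm_zero] at this
    exact lt_irrefl _ this

theorem exists_norm_le_of_tendsto {g : A → A} {Ω : Set A} {b : A}
    (hg : Tendsto g (𝓝[Ω] (y • (1 : A))) (𝓝 b)) :
    ∃ U ∈ 𝓝[Ω] (y • (1 : A)), U ⊆ Ω ∧ ∃ M : ℝ, ∀ x ∈ U, ‖g x‖ ≤ M := by
  have h1 : ∀ᶠ x in 𝓝[Ω] (y • (1 : A)), ‖g x‖ < ‖b‖ + 1 :=
    hg.norm.eventually_lt_const (lt_add_one _)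
  exact ⟨{x | ‖g x‖ < ‖b‖ + 1} ∩ Ω, inter_mem h1 self_mem_nhdsWithin, Set.inter_subset_right,
    ‖b‖ + 1, fun x hx => le_of_lt hx.1⟩

include hnorm hopen hy hf

/-- The stem function near the isolated singularity. -/
theorem exists_local_stem {J : A} (hJ : J ∈ imagUnits A) :
    ∃ (R : ℝ) (F : ℂ → A × A), 0 < R ∧ (puncturedBall y R : Set A) ⊆ Ωt \ {y • (1 : A)} ∧
      Metric.ball (y : ℂ) R \ {(y : ℂ)} ⊆ sliceEmb J ⁻¹' (Ωt \ {y • (1 : A)}) ∧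
      IsInducedOn (sliceEmb J ⁻¹' (Ωt \ {y • (1 : A)})) F f ∧
      DifferentiableOn ℂ (cplxCoord A ∘ F) (sliceEmb J ⁻¹' (Ωt \ {y • (1 : A)})) ∧
      ∀ z ∈ sliceEmb J ⁻¹' (Ωt \ {y • (1 : A)}),
        cplxCoord A (F (star z)) = star (cplxCoord A (F z)) := by
  obtain ⟨R, hR, hsub⟩ := exists_puncturedBall_subset hopen hy
  obtain ⟨F, h1, h2, h3⟩ := hf.exists_stem hJ
  exact ⟨R, F, hR, hsub, fun z hz => hsub ((sliceEmb_mem_puncturedBall_iff hnorm hJ).2 hz), h2, h3,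
    isStemOn_iff.1 h1⟩

include hS

theorem existsUnique_hasLaurentExpansion :
    ∃! a : ℤ → A, HasLaurentExpansion (Ωt \ {y • (1 : A)}) f y a := by
  obtain ⟨J, hJ⟩ := hS
  obtain ⟨R, F, hR, hsub, hball, hind, hdiff, hstar⟩ := exists_local_stem hnorm hopen hy hf hJ
  have hdiff' := hdiff.mono hball
  refine ⟨_, hasLaurentExpansion_of_stem hnorm hJ hR hball hind hdiff'
    (fun z hz => hstar z (hball hz)) hsub (half_pos hR) (half_lt_self hR), fun a ha => ?_⟩
  funext n
  have := HasLaurentExpansion.cplxCoord_eq hnorm hJ hR hball hind hdiff' ha (half_pos hR)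
    (half_lt_self hR) n
  simp only [← this, ContinuousLinearEquiv.symm_apply_apply]

theorem hasLaurentExpansion_laurentCoeff :
    HasLaurentExpansion (Ωt \ {y • (1 : A)}) f y (laurentCoeff (Ωt \ {y • (1 : A)}) f y) := by
  have h := (existsUnique_hasLaurentExpansion hS hnorm hopen hy hf).exists
  rw [laurentCoeff, dif_pos h]
  exact h.choose_spec

theorem principalPartBound_of_norm_le {k : ℕ} {U : Set A} {M : ℝ}
    (hU : U ∈ 𝓝[Ωt] (y • (1 : A)))
    (hM : ∀ x ∈ U \ {y • (1 : A)}, ‖pow (x - y • (1 : A)) k * f x‖ ≤ M) :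
    PrincipalPartBound (Ωt \ {y • (1 : A)}) f y k := by
  have hL := hasLaurentExpansion_laurentCoeff hS hnorm hopen hy hf
  obtain ⟨J, hJ⟩ := hS
  obtain ⟨R, F, hR, hsub, hball, hind, hdiff, -⟩ := exists_local_stem hnorm hopen hy hf hJ
  obtain ⟨ε, hε, hεU⟩ := exists_ball_of_mem_nhdsWithin hnorm hU
  intro n hn
  have h1 := HasLaurentExpansion.cplxCoord_eq hnorm hJ hR hball hind (hdiff.mono hball) hL
    (half_pos hR) (half_lt_self hR) (-(n : ℤ))
  rw [circleCoeff_eq_zero_of_norm_le hnorm hJ hR hball hind (hdiff.mono hball) hε k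
    (fun z hz _ K hK hzΩ => hM _ ⟨hεU z K hK hz hzΩ.1, hzΩ.2⟩) (half_pos hR) (half_lt_self hR)
    hf.isCircular hn, map_eq_zero_iff _ (cplxCoord A).injective] at h1
  exact congrArg Prod.fst h1

include hcirc

/-- The map `(z - y)^k F` has no coefficients of negative index, so it extends holomorphically over
`y`, with value `a_{-k}` there. This value lies in `A`, so conjugation symmetry persists and the
induced value at `y` is the same for all units. -/
theorem exists_sliceRegularOn_of_principalPartBound {k : ℕ}
    (hk : PrincipalPartBound (Ωt \ {y • (1 : A)}) f y k) :
    ∃ g : A → A, SliceRegularOn g Ωt ∧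
      (∀ x ∈ Ωt \ {y • (1 : A)}, g x = pow (x - y • (1 : A)) k * f x) ∧
      g (y • (1 : A)) = laurentCoeff (Ωt \ {y • (1 : A)}) f y (-(k : ℤ)) := by
  classical
  have hL := hasLaurentExpansion_laurentCoeff hS hnorm hopen hy hf
  obtain ⟨J, hJ⟩ := hS
  obtain ⟨R, F, hR, hsub, hball, hind, hdiff, hstar⟩ := exists_local_stem hnorm hopen hy hf hJ
  set a := laurentCoeff (Ωt \ {y • (1 : A)}) f y with ha
  set D := sliceEmb J ⁻¹' Ωt with hDdef
  rw [preimage_sliceEmb_diff hJ] at hball hind hdiff hstar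
  have hD : IsOpen D := hopen.isOpen_preimage hJ
  have hD' : IsOpen (D \ {(y : ℂ)}) := hD.sdiff isClosed_singleton
  have hyD : (y : ℂ) ∈ D := by simpa [hDdef] using hy
  have hρ := half_pos hR
  have hρR := half_lt_self hR
  have hcoef : ∀ n, cplxCoord A (a n, 0) = circleCoeff (cplxCoord A ∘ F) y (R / 2) n := fun n =>
    HasLaurentExpansion.cplxCoord_eq hnorm hJ hR (by rwa [preimage_sliceEmb_diff hJ])
      (by rwa [preimage_sliceEmb_diff hJ]) (hdiff.mono hball) hL hρ hρR n
  set h : ℂ → Fin (Module.finrank ℝ A) → ℂ := fun z => (z - y) ^ (k : ℤ) • (cplxCoord A ∘ F) z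
    with hh
  have hhd : DifferentiableOn ℂ h (D \ {(y : ℂ)}) := fun z hz =>
    (differentiableAt_sub_zpow _ hz.2).differentiableWithinAt.smul (hdiff z hz)
  have hh0 : ∀ n : ℤ, n < 0 → circleCoeff h y (R / 2) n = 0 := fun n hn => by
    rw [hh, circleCoeff_zpow_smul hρ, ← hcoef]
    obtain ⟨m, hm⟩ := Int.eq_ofNat_of_zero_le (show 0 ≤ k - n by omega)
    rw [show n - k = -(m : ℤ) by omega, ha, hk m (by omega), ← Prod.zero_eq_mk, map_zero]
  obtain ⟨P, hP, hPh, hPy⟩ := exists_extension_of_circleCoeff_eq_zero (hhd.mono hball) hρ hρR hh0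
  have hPy' : P y = cplxCoord A (a (-(k : ℤ)), 0) := by
    rw [hPy, hh, circleCoeff_zpow_smul hρ, zero_sub, hcoef]
  -- At `y` itself `F` is arbitrary, so the value of `h` there is replaced by that of the extension
  -- `P`.
  set G : ℂ → Fin (Module.finrank ℝ A) → ℂ := Function.update h y (P y) with hG
  have hGh : ∀ z : ℂ, z ≠ y → G z = h z := fun z hz => Function.update_of_ne hz _ _
  have hGy : G y = P y := Function.update_self _ _ _
  have hGd : DifferentiableOn ℂ G D := by
    intro z hz
    by_cases hzy : z = y
    · have hev : G =ᶠ[𝓝 z] P := by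
        rw [hzy]
        filter_upwards [Metric.ball_mem_nhds (y : ℂ) hρ] with w hw
        by_cases hwy : w = y
        · rw [hwy, hGy]
        · rw [hGh w hwy, hPh ⟨hw, hwy⟩]
      refine (hev.differentiableAt_iff.2 ?_).differentiableWithinAt
      rw [hzy]
      exact hP.differentiableAt (Metric.ball_mem_nhds _ hρ)
    · have hev : G =ᶠ[𝓝 z] h := by
        filter_upwards [hD'.mem_nhds ⟨hz, hzy⟩] with w hw using hGh w hw.2
      exact (hev.differentiableAt_iff.2 (hhd.differentiableAt
        (hD'.mem_nhds ⟨hz, hzy⟩))).differentiableWithinAt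
  refine ⟨fun x => if x = y • (1 : A) then a (-(k : ℤ)) else pow (x - y • (1 : A)) k * f x,
    sliceRegularOn_of_stem hcirc hopen hJ ⟨y, hyD⟩ (F := (cplxCoord A).symm ∘ G) ?_ ?_ ?_, ?_, ?_⟩
  · rw [isStemOn_iff]
    intro z hz
    simp only [Function.comp_apply, ContinuousLinearEquiv.apply_symm_apply]
    by_cases hzy : z = y
    · have : star z = y := by rw [hzy]; simp
      rw [this, hzy, hGy, hPy', ← cplxCoord_conj, neg_zero]
    · have hsy : star z - y = star (z - y) := by simp
      have hszy : star z ≠ y := fun h0 => hzy (by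
        rw [← sub_eq_zero, hsy, star_eq_zero, sub_eq_zero] at h0; exact h0)
      rw [hGh _ hzy, hGh _ hszy, hh]
      simp only [Function.comp_apply, hstar z ⟨hz, hzy⟩, star_smul, star_zpow₀, hsy]
  · intro z hz K hK
    simp only [sliceEmb_eq_smul_one_iff hK, Function.comp_apply]
    split_ifs with hzy
    · rw [hzy, hGy, hPy', ContinuousLinearEquiv.symm_apply_apply]
      simp [evalAt]
    · rw [hGh z hzy, hind z ⟨hz, hzy⟩ K hK,
        pow_sliceEmb_sub_mul_evalAt (mul_self_of_mem_imagUnits hK), hh]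
      simp only [Function.comp_apply, zpow_natCast, cplxCoord_symm_smul,
        ContinuousLinearEquiv.symm_apply_apply]
  · refine hGd.congr fun z _ => ?_
    simp
  · intro x hx
    exact if_neg hx.2
  · exact if_pos rfl

/-- The real points `y + r` approach `y`, so limits along the punctured set are unique. -/
theorem neBot_nhdsWithin_diff : (𝓝[Ωt \ {y • (1 : A)}] (y • (1 : A))).NeBot := by
  obtain ⟨J, hJ⟩ := hS
  obtain ⟨R, hR, hsub⟩ := exists_puncturedBall_subset hopen hy
  rw [← mem_closure_iff_nhdsWithin_neBot, Metric.mem_closure_iff]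
  intro ε hε
  obtain ⟨r, hr, hrlt⟩ := exists_between (lt_min hε hR)
  have h1 : ‖sliceEmb J ((y : ℂ) + r) - y • (1 : A)‖ = r := by
    rw [norm_sliceEmb_sub hnorm hJ]; simp [abs_of_pos hr]
  refine ⟨sliceEmb J ((y : ℂ) + r), hsub ⟨sliceEmb_mem_quadraticCone hJ _, by rwa [h1], ?_⟩, ?_⟩
  · rw [h1]; exact hrlt.trans_le (min_le_right _ _)
  · rw [dist_comm, dist_eq_norm, h1]; exact hrlt.trans_le (min_le_left _ _)

/-- A slice regular extension of `(x - y) ^ k * f x` bounds the principal part, and its value at `y`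
is the Laurent coefficient of index `-k`. -/
theorem principalPartBound_of_sliceRegularOn {k : ℕ} {Ω' : Set A} {g : A → A}
    (hg : SliceRegularOn g Ω') (hΩ : Ωt \ {y • (1 : A)} ⊆ Ω') (hyΩ : y • (1 : A) ∈ Ω')
    (hgf : ∀ x ∈ Ωt \ {y • (1 : A)}, g x = pow (x - y • (1 : A)) k * f x) :
    PrincipalPartBound (Ωt \ {y • (1 : A)}) f y k ∧
      g (y • (1 : A)) = laurentCoeff (Ωt \ {y • (1 : A)}) f y (-(k : ℤ)) := by
  have hlim := hg.tendsto_nhdsWithin hnorm hS hyΩ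
  have hsub : Ωt ⊆ Ω' := fun x hx => by
    by_cases h : x = y • (1 : A)
    · rwa [h]
    · exact hΩ ⟨hx, h⟩
  obtain ⟨U, hU, hUΩ, M, hM⟩ := exists_norm_le_of_tendsto (hlim.mono_left
    (nhdsWithin_mono _ hsub))
  have hb := principalPartBound_of_norm_le hS hnorm hopen hy hf (k := k) hU (M := M)
    fun x hx => by rw [← hgf x ⟨hUΩ hx.1, hx.2⟩]; exact hM x hx.1
  refine ⟨hb, ?_⟩
  obtain ⟨g', hg', hgf', hgy⟩ :=
    exists_sliceRegularOn_of_principalPartBound hS hnorm hcirc hopen hy hf hb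
  have hlim' := hg'.tendsto_nhdsWithin hnorm hS hy
  have := neBot_nhdsWithin_diff hS hnorm hcirc hopen hy hf
  rw [← hgy]
  -- Both `g` and the extension `g'` built from the Laurent series are continuous at `y` and agree
  -- off `y`, hence share their value there.
  refine tendsto_nhds_unique (hlim.mono_left (nhdsWithin_mono _ hΩ))
    ((hlim'.mono_left (nhdsWithin_mono _ Set.sdiff_subset)).congr' ?_)
  filter_upwards [self_mem_nhdsWithin] with x hx
  rw [hgf x hx, hgf' x hx]

theorem principalPartBound_iff_exists_norm_le {k : ℕ} :
    PrincipalPartBound (Ωt \ {y • (1 : A)}) f y k ↔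
      ∃ U ∈ 𝓝[Ωt] (y • (1 : A)), U ⊆ Ωt ∧ ∃ M : ℝ, ∀ x ∈ U \ {y • (1 : A)},
        ‖pow (x - y • (1 : A)) k * f x‖ ≤ M := by
  constructor
  · intro h
    obtain ⟨g, hg, hgf, -⟩ := exists_sliceRegularOn_of_principalPartBound hS hnorm hcirc hopen hy hf h
    obtain ⟨U, hU, hUΩ, M, hM⟩ := exists_norm_le_of_tendsto (hg.tendsto_nhdsWithin hnorm hS hy)
    refine ⟨U, hU, hUΩ, M, fun x hx => ?_⟩
    rw [← hgf x ⟨hUΩ hx.1, hx.2⟩]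
    exact hM x hx.1
  · rintro ⟨U, hU, -, M, hM⟩
    exact principalPartBound_of_norm_le hS hnorm hopen hy hf hU hM

theorem isRemovableSingularity_iff :
    IsRemovableSingularity (Ωt \ {y • (1 : A)}) f y ↔
      PrincipalPartBound (Ωt \ {y • (1 : A)}) f y 0 := by
  constructor
  · rintro ⟨-, Ω', g, hΩ, hyΩ, hg, hgf⟩
    exact (principalPartBound_of_sliceRegularOn hS hnorm hcirc hopen hy hf hg hΩ hyΩ
      fun x hx => by rw [hgf hx, pow, one_mul]).1
  · intro h
    obtain ⟨g, hg, hgf, -⟩ := exists_sliceRegularOn_of_principalPartBound hS hnorm hcirc hopen hy hf h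
    exact ⟨exists_puncturedBall_subset hopen hy, Ωt, g, Set.sdiff_subset, hy, hg,
      fun x hx => by rw [hgf x hx, pow, one_mul]⟩

/-- From `‖g x‖ ≤ C ‖x - y‖^k ‖f x‖` it follows that `‖f x‖` is at least `‖g x‖ / (C ‖x - y‖^k)`,
whose numerator has a positive limit. -/
theorem tendsto_norm_atTop_of_sliceRegularOn {k : ℕ} (hk : k ≠ 0) {g : A → A}
    (hg : SliceRegularOn g Ωt)
    (hgf : ∀ x ∈ Ωt \ {y • (1 : A)}, g x = pow (x - y • (1 : A)) k * f x)
    (hne : g (y • (1 : A)) ≠ 0) :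
    Tendsto (fun x => ‖f x‖) (𝓝[Ωt \ {y • (1 : A)}] (y • (1 : A))) atTop := by
  obtain ⟨C, hC, hCb⟩ := exists_norm_mul_le (A := A)
  set Ω := Ωt \ {y • (1 : A)} with hΩ
  have hlim : Tendsto (fun x => ‖g x‖) (𝓝[Ω] (y • (1 : A))) (𝓝 ‖g (y • (1 : A))‖) :=
    ((hg.tendsto_nhdsWithin hnorm hS hy).mono_left (nhdsWithin_mono _ Set.sdiff_subset)).norm
  have hsmall : Tendsto (fun x : A => C * ‖x - y • (1 : A)‖ ^ k) (𝓝[Ω] (y • (1 : A))) (𝓝[>] 0) := by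
    refine tendsto_nhdsWithin_iff.2 ⟨?_, ?_⟩
    · have : Continuous fun x : A => C * ‖x - y • (1 : A)‖ ^ k := by fun_prop
      have h0 := (this.tendsto (y • (1 : A))).mono_left (nhdsWithin_le_nhds (s := Ω))
      simpa [hk] using h0
    · filter_upwards [self_mem_nhdsWithin] with x hx
      have : 0 < ‖x - y • (1 : A)‖ := norm_pos_iff.2 (sub_ne_zero.2 hx.2)
      exact Set.mem_Ioi.2 (by positivity)
  refine tendsto_atTop_mono' _ ?_
    (hlim.pos_mul_atTop (norm_pos_iff.2 hne) (tendsto_inv_nhdsGT_zero.comp hsmall))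
  obtain ⟨J, hJ⟩ := hS
  filter_upwards [self_mem_nhdsWithin] with x hx
  have hxpos : 0 < ‖x - y • (1 : A)‖ := norm_pos_iff.2 (sub_ne_zero.2 hx.2)
  -- Within the cone the norm respects powers, because a slice embedding is an isometric
  -- homomorphism.
  have hpow : ‖pow (x - y • (1 : A)) k‖ = ‖x - y • (1 : A)‖ ^ k := by
    obtain ⟨z, -, K, hK, rfl⟩ := exists_eq_sliceEmb hcirc hJ hx.1
    rw [norm_sliceEmb_sub hnorm hK, ← sliceEmb_ofReal K, ← sliceEmb_sub,
      pow_sliceEmb (mul_self_of_mem_imagUnits hK), norm_sliceEmb hnorm hK, norm_pow]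
  have h1 := hCb (pow (x - y • (1 : A)) k) (f x)
  rw [← hgf x hx, hpow] at h1
  rw [Function.comp_apply, ← div_eq_mul_inv, div_le_iff₀ (by positivity)]
  linarith

end Main

end SliceRegular
-- The classification, read off from the order
theorem mainTheorem4 {A : Type*} [NormedAlternativeRing A] [Nontrivial A] [StarRing A]
    [NormedSpace ℝ A] [IsScalarTower ℝ A A] [SMulCommClass ℝ A A] [StarModule ℝ A]
    [FiniteDimensional ℝ A]
    (hS : (SliceRegular.imagUnits A).Nonempty)
    (hnorm : ∀ x ∈ SliceRegular.quadraticCone A, (‖x‖ ^ 2) • (1 : A) = x * star x)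
    (Ωt : Set A) (hcirc : SliceRegular.IsCircular Ωt) (hopen : SliceRegular.IsOpenInCone Ωt)
    (y : ℝ) (hy : y • (1 : A) ∈ Ωt)
    (Ω : Set A) (hΩ : Ω = Ωt \ {y • (1 : A)})
    (f : A → A) (hf : SliceRegular.SliceRegularOn f Ω) :
    -- `y` is a singularity, and the order refers to a Laurent expansion that exists and is unique
    (SliceRegular.IsSingularity Ω y ∧ ∃! a : ℤ → A, SliceRegular.HasLaurentExpansion Ω f y a) ∧
    -- the trichotomy
    (SliceRegular.IsRemovableSingularity Ω f y ∨
      (SliceRegular.IsPole Ω f y ∧ ¬ SliceRegular.IsRemovableSingularity Ω f y) ∨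
      SliceRegular.IsEssentialSingularity Ω f y) ∧
    -- 1a, 1b
    (SliceRegular.IsRemovableSingularity Ω f y ↔ SliceRegular.order Ω f y = 0) ∧
    (SliceRegular.IsRemovableSingularity Ω f y ↔
      ∃ U ∈ 𝓝[Ωt] (y • (1 : A)), U ⊆ Ωt ∧ ∃ M : ℝ, ∀ x ∈ U \ {y • (1 : A)}, ‖f x‖ ≤ M) ∧
    -- 2a, 2b
    ((SliceRegular.IsPole Ω f y ∧ ¬ SliceRegular.IsRemovableSingularity Ω f y) ↔
      (SliceRegular.order Ω f y ≠ ⊤ ∧ 0 < SliceRegular.order Ω f y)) ∧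
    ((SliceRegular.IsPole Ω f y ∧ ¬ SliceRegular.IsRemovableSingularity Ω f y) ↔
      ∃ k : ℕ, k ≠ 0 ∧ ∃ g : A → A, SliceRegular.SliceRegularOn g Ωt ∧
        (∀ x ∈ Ω, g x = SliceRegular.pow (x - y • (1 : A)) k * f x) ∧ g (y • (1 : A)) ≠ 0) ∧
    -- the supplement to 2b
    (∀ k : ℕ, k ≠ 0 → ∀ g : A → A, SliceRegular.SliceRegularOn g Ωt →
      (∀ x ∈ Ω, g x = SliceRegular.pow (x - y • (1 : A)) k * f x) → g (y • (1 : A)) ≠ 0 →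
        SliceRegular.order Ω f y = (k : ℕ∞) ∧
        Tendsto (fun x => ‖f x‖) (𝓝[Ω] (y • (1 : A))) atTop) ∧
    -- 3a, 3b
    (SliceRegular.IsEssentialSingularity Ω f y ↔ SliceRegular.order Ω f y = ⊤) ∧
    (SliceRegular.IsEssentialSingularity Ω f y ↔
      ∀ U ∈ 𝓝[Ωt] (y • (1 : A)), U ⊆ Ωt → ∀ k : ℕ, ∀ M : ℝ,
        ∃ x ∈ U \ {y • (1 : A)}, M < ‖SliceRegular.pow (x - y • (1 : A)) k * f x‖) := by
  subst hΩ
  have hsing : SliceRegular.IsSingularity (Ωt \ {y • (1 : A)}) y :=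
    SliceRegular.exists_puncturedBall_subset hopen hy
  have hrem := SliceRegular.isRemovableSingularity_iff hS hnorm hcirc hopen hy hf
  have hbdd := @SliceRegular.principalPartBound_iff_exists_norm_le _ _ _ _ _ _ _ _ _ hS hnorm _
    hcirc hopen _ hy _ hf
  have hord0 := SliceRegular.order_eq_zero_iff (Ω := Ωt \ {y • (1 : A)}) (f := f) (y := y)
  have hpole : SliceRegular.IsPole (Ωt \ {y • (1 : A)}) f y ↔
      SliceRegular.order (Ωt \ {y • (1 : A)}) f y ≠ ⊤ := by
    rw [Ne, SliceRegular.order_eq_top_iff]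
    push Not
    exact and_iff_right hsing
  have hess : SliceRegular.IsEssentialSingularity (Ωt \ {y • (1 : A)}) f y ↔
      SliceRegular.order (Ωt \ {y • (1 : A)}) f y = ⊤ := by
    rw [SliceRegular.IsEssentialSingularity, hpole, and_iff_right hsing, not_not]
  have hpnr : (SliceRegular.IsPole (Ωt \ {y • (1 : A)}) f y ∧
      ¬ SliceRegular.IsRemovableSingularity (Ωt \ {y • (1 : A)}) f y) ↔
      (SliceRegular.order (Ωt \ {y • (1 : A)}) f y ≠ ⊤ ∧
        0 < SliceRegular.order (Ωt \ {y • (1 : A)}) f y) := by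
    rw [hpole, hrem, ← hord0, pos_iff_ne_zero]
  -- The extension bounds the principal part by `k`, and its nonzero value at `y` is `a_{-k}`, so no
  -- smaller bound holds.
  have hsupp : ∀ k : ℕ, ∀ g : A → A, SliceRegular.SliceRegularOn g Ωt →
      (∀ x ∈ Ωt \ {y • (1 : A)}, g x = SliceRegular.pow (x - y • (1 : A)) k * f x) →
      g (y • (1 : A)) ≠ 0 → SliceRegular.order (Ωt \ {y • (1 : A)}) f y = (k : ℕ∞) := by
    intro k g hg hgf hne
    obtain ⟨h1, h2⟩ := SliceRegular.principalPartBound_of_sliceRegularOn hS hnorm hcirc hopen hy hf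
      hg Set.sdiff_subset hy hgf
    exact SliceRegular.order_eq_of_laurentCoeff_ne_zero h1 (h2 ▸ hne)
  refine ⟨⟨hsing, SliceRegular.existsUnique_hasLaurentExpansion hS hnorm hopen hy hf⟩, ?_,
    hrem.trans hord0.symm, ?_, hpnr, ?_, ?_, hess, ?_⟩
  · rw [hpnr, hess, hrem, ← hord0, pos_iff_ne_zero]
    tauto
  · rw [hrem, hbdd]
    simp only [SliceRegular.pow, one_mul]
  · rw [hpnr]
    constructor
    · rintro ⟨h1, h2⟩
      obtain ⟨k, hk, hkb, hkne⟩ := SliceRegular.exists_principalPartBound_of_order h1 h2.ne'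
      obtain ⟨g, hg, hgf, hgy⟩ := SliceRegular.exists_sliceRegularOn_of_principalPartBound hS hnorm
        hcirc hopen hy hf hkb
      exact ⟨k, hk, g, hg, hgf, hgy ▸ hkne⟩
    · rintro ⟨k, hk, g, hg, hgf, hne⟩
      rw [hsupp k g hg hgf hne]
      exact ⟨ENat.natCast_ne_top k, by exact_mod_cast Nat.pos_of_ne_zero hk⟩
  · exact fun k hk g hg hgf hne => ⟨hsupp k g hg hgf hne,
      SliceRegular.tendsto_norm_atTop_of_sliceRegularOn hS hnorm hcirc hopen hy hf hk hg hgf hne⟩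
  · rw [hess, SliceRegular.order_eq_top_iff]
    constructor
    · intro h U hU hUΩ k M
      by_contra! hcon
      exact h k (hbdd.2 ⟨U, hU, hUΩ, M, hcon⟩)
    · intro h k hk
      obtain ⟨U, hU, hUΩ, M, hM⟩ := hbdd.1 hk
      obtain ⟨x, hx, hlt⟩ := h U hU hUΩ k M
      exact absurd (hM x hx) (not_le.2 hlt)
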